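/- For $g\ge 2$ let $\Sigma_g$ be the closed orientable surface of genus $g$, i.e. (up to homeomorphism) the quotient of a closed $4g$-gon by the side pairing with boundary word $a_1b_1a_1^{-1}b_1^{-1}\cdots a_gb_ga_g^{-1}b_g^{-1}$, and let $\Gamma=\pi_1(\Sigma_g)$ be its fundamental group (at any base point). Let $\operatorname{Sym}(\mathbb Z)$ be the group of all permutations of $\mathbb Z$ with the topology of pointwise convergence, i.e. the subspace topology from $\mathbb Z^{\mathbb Z}$ with $\mathbb Z$ discrete. Then $\operatorname{Sym}(\mathbb Z)$ has a dense subgroup isomorphic to $\Gamma$. Equivalently, $\Gamma$ has a faithful, highly transitive action on a countably infinite set, where an action is highly transitive if for every $k\in\mathbb N$ it is transitive on ordered $k$-tuples of distinct elements. -/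

import Mathlib

/-- The topology of pointwise convergence on `Sym(ℤ)`: the restriction to the permutations of the
product topology on `ℤ → ℤ`, where `ℤ` is discrete. -/
instance permIntTopology : TopologicalSpace (Equiv.Perm ℤ) :=
  TopologicalSpace.induced (fun σ : Equiv.Perm ℤ => (σ : ℤ → ℤ)) inferInstance

/-- The closed unit disc, regarded as a polygon with `4 * g` sides. -/
abbrev PolygonDisc : Type := Metric.closedBall (0 : ℂ) 1

/-- The point `exp (2 π i s / (4 g))` of the boundary circle; the `k`-th side of the `4 * g`-gon
(`0 ≤ k < 4 * g`) is the arc of those with `k ≤ s ≤ k + 1`. -/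
noncomputable def boundaryPoint (g : ℕ) (s : ℝ) : PolygonDisc :=
  ⟨Complex.exp ((2 * Real.pi * s / (4 * g) : ℝ) * Complex.I), by
    rw [mem_closedBall_zero_iff, Complex.norm_exp_ofReal_mul_I]⟩

/-- The side pairing of the `4 * g`-gon with boundary word
`a₁ b₁ a₁⁻¹ b₁⁻¹ ⋯ a_g b_g a_g⁻¹ b_g⁻¹`. -/
inductive SidePairing (g : ℕ) : PolygonDisc → PolygonDisc → Prop
  | a (j : Fin g) (t : ℝ) (ht : t ∈ Set.Icc (0 : ℝ) 1) :
      SidePairing g (boundaryPoint g (4 * (j : ℕ) + t)) (boundaryPoint g (4 * (j : ℕ) + 3 - t))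
  | b (j : Fin g) (t : ℝ) (ht : t ∈ Set.Icc (0 : ℝ) 1) :
      SidePairing g (boundaryPoint g (4 * (j : ℕ) + 1 + t)) (boundaryPoint g (4 * (j : ℕ) + 4 - t))

/-- The closed orientable surface `Σ_g` of genus `g` (for `g ≥ 1`): the `4 * g`-gon modulo the
equivalence relation generated by the side pairing, with the quotient topology. -/
def ClosedSurface (g : ℕ) : Type := Quot (SidePairing g)

instance ClosedSurface.instTopologicalSpace (g : ℕ) : TopologicalSpace (ClosedSurface g) :=
  inferInstanceAs (TopologicalSpace (Quot (SidePairing g)))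

/-- An action is highly transitive if it is `k`-transitive, i.e. transitive on ordered `k`-tuples
of distinct elements, for every `k`. -/
def IsHighlyTransitive (G Y : Type*) [Group G] [MulAction G Y] : Prop :=
  ∀ k : ℕ, MulAction.IsMultiplyPretransitive G Y k

/-!
The surface group is an amalgam of two free groups, one on the two generators of the first handle
and one on the generators of the remaining handles, along the infinite cyclic group generated by the
commutator `c` of the first handle, which equals the inverse `d` of the product of the other
commutators. Let both free groups act freely and with infinitely many orbits on countable sets, and
glue the two actions along a bijection of these sets that intertwines `c` with `d`. The bijection is
a generic one: it is given by an ideal of finite matchings that meets countably many dense sets of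
matchings. Genericity makes every nontrivial reduced word move a point, and it carries any tuple to
any other one, because a power of a generator `a` moves a given tuple off any finite union of
`⟨c⟩`-orbits. The reason for the latter is that no nontrivial power of `c` is conjugate by a nonzero
power of `a` into `⟨c⟩`, which is visible in the affine maps of `ℤ[T;T⁻¹]`.

On the topological side, the surface is covered by patches (the interior of the polygon, the sectors
over its sides and the sectors around its corners) which contract along paths that lift to the
polygon. Hence the fundamental group is generated by the loops that jump across a pair of sides. Of
the universal property of the presentation only homomorphisms to permutation groups are needed, and
these are the monodromies of coverings glued from locally constant labels on the patches.
-/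

/-! ### Generic equivariant bijections -/

section Matching

variable {H K L R : Type*} [Group H] [Group K] [MulAction H L] [MulAction K R]

/-- The `H`-orbit of `x` is disjoint from `O`. -/
def Fresh (H : Type*) {L : Type*} [Group H] [MulAction H L] (O : Set L) (x : L) : Prop :=
  ∀ h : H, h • x ∉ O

/-- The `⟨c⟩`-orbit of `x` is disjoint from `O`. -/
def Unmet (c : H) (O : Set L) (x : L) : Prop :=
  ∀ n : ℤ, c ^ n • x ∉ O

/-- Inside its `H`-orbit, `x` reaches `O` only along its `⟨c⟩`-orbit. -/
def MeetsByPowers (c : H) (O : Set L) (x : L) : Prop :=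
  ∀ h : H, h • x ∈ O → h ∈ Subgroup.zpowers c

lemma exists_fresh [Infinite (MulAction.orbitRel.Quotient H L)] {O : Set L} (hO : O.Finite) :
    ∃ x, Fresh H O x := by
  obtain ⟨q, hq⟩ := (hO.image (Quotient.mk (MulAction.orbitRel H L))).infinite_compl.nonempty
  induction q using Quotient.inductionOn with | h x =>
  exact ⟨x, fun h hx => hq ⟨_, hx, Quotient.sound (MulAction.mem_orbit x h)⟩⟩

lemma Fresh.unmet {O : Set L} {x : L} (hx : Fresh H O x) (c : H) : Unmet c O x :=
  fun n => hx (c ^ n)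

lemma Fresh.mono {O O' : Set L} {x : L} (hx : Fresh H O x) (h : O' ⊆ O) : Fresh H O' x :=
  fun g hg => hx g (h hg)

lemma Unmet.mono {c : H} {O O' : Set L} {x : L} (hx : Unmet c O x) (h : O' ⊆ O) : Unmet c O' x :=
  fun n hn => hx n (h hn)

lemma Unmet.insert {c : H} {O : Set L} {x y : L} (hx : Unmet c O x) (hy : ∀ n : ℤ, c ^ n • x ≠ y) :
    Unmet c (insert y O) x :=
  fun n hn => hn.elim (hy n) (hx n)

lemma Fresh.meetsByPowers_insert [IsCancelSMul H L] {O : Set L} {x : L} (hx : Fresh H O x)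
    (c : H) : MeetsByPowers c (insert x O) x := by
  rintro h (hh | hh)
  · rw [IsCancelSMul.eq_one_of_smul hh]
    exact one_mem _
  · exact absurd hh (hx h)

lemma MeetsByPowers.insert_zpow_smul [IsCancelSMul H L] {c : H} {O : Set L} {x : L}
    (hx : MeetsByPowers c O x) (n : ℤ) : MeetsByPowers c (insert (c ^ n • x) O) x := by
  rintro h (hh | hh)
  · rw [IsCancelSMul.right_cancel _ _ _ hh]
    exact Subgroup.zpow_mem_zpowers c n
  · exact hx h hh

lemma MeetsByPowers.zpow_smul {c : H} {O : Set L} {x : L} (hx : MeetsByPowers c O x) (n : ℤ) :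
    MeetsByPowers c O (c ^ n • x) := by
  intro h hh
  rw [← mul_smul] at hh
  exact (Subgroup.mul_mem_cancel_right _ (Subgroup.zpow_mem_zpowers c n)).1 (hx _ hh)

lemma MeetsByPowers.unmet_smul {c : H} {O : Set L} {x : L} (hx : MeetsByPowers c O x) {h : H}
    (hh : h ∉ Subgroup.zpowers c) : Unmet c O (h • x) := by
  intro n hn
  rw [← mul_smul] at hn
  exact hh ((Subgroup.mul_mem_cancel_left _ (Subgroup.zpow_mem_zpowers c n)).1 (hx _ hn))

/-- A finite set of pairs which is contained in the graph of a bijection between unions of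
`⟨c⟩`-orbits and of `⟨d⟩`-orbits that intertwines `c` and `d`. -/
structure IsFiniteMatching (c : H) (d : K) (S : Set (L × R)) : Prop where
  finite : S.Finite
  eq_smul_iff : ∀ p ∈ S, ∀ q ∈ S, ∀ n : ℤ, q.1 = c ^ n • p.1 ↔ q.2 = d ^ n • p.2

variable {c a : H} {d b : K} {S : Set (L × R)}

namespace IsFiniteMatching

lemma empty (c : H) (d : K) : IsFiniteMatching c d (∅ : Set (L × R)) :=
  ⟨Set.finite_empty, by simp⟩

lemma swap (hS : IsFiniteMatching c d S) : IsFiniteMatching d c (Prod.swap '' S) := by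
  refine ⟨hS.finite.image _, ?_⟩
  rintro _ ⟨p, hp, rfl⟩ _ ⟨q, hq, rfl⟩ n
  exact (hS.eq_smul_iff p hp q hq n).symm

lemma insert_unmet [IsCancelSMul H L] [IsCancelSMul K R] (hcd : ∀ n : ℤ, c ^ n = 1 ↔ d ^ n = 1)
    (hS : IsFiniteMatching c d S) {x : L} {y : R} (hx : Unmet c (Prod.fst '' S) x)
    (hy : Unmet d (Prod.snd '' S) y) : IsFiniteMatching c d (insert (x, y) S) := by
  refine ⟨hS.finite.insert _, ?_⟩
  rintro p (rfl | hp) q (rfl | hq) n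
  · have hfree : x = c ^ n • x ↔ c ^ n = 1 :=
      ⟨fun h => IsCancelSMul.eq_one_of_smul h.symm, fun h => by rw [h, one_smul]⟩
    have hfree' : y = d ^ n • y ↔ d ^ n = 1 :=
      ⟨fun h => IsCancelSMul.eq_one_of_smul h.symm, fun h => by rw [h, one_smul]⟩
    exact hfree.trans ((hcd n).trans hfree'.symm)
  · exact iff_of_false (fun h => hx n ⟨q, hq, h⟩) (fun h => hy n ⟨q, hq, h⟩)
  · rw [← inv_smul_eq_iff, ← inv_smul_eq_iff, ← zpow_neg, ← zpow_neg]
    exact iff_of_false (fun h => hx (-n) ⟨p, hp, h.symm⟩) (fun h => hy (-n) ⟨p, hp, h.symm⟩)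
  · exact hS.eq_smul_iff p hp q hq n

lemma insert_smul (hS : IsFiniteMatching c d S) {p : L × R} (hp : p ∈ S) (m : ℤ) :
    IsFiniteMatching c d (insert (c ^ m • p.1, d ^ m • p.2) S) := by
  have translate : ∀ q ∈ insert (c ^ m • p.1, d ^ m • p.2) S, ∃ q' ∈ S, ∃ k : ℤ,
      q.1 = c ^ k • q'.1 ∧ q.2 = d ^ k • q'.2 := by
    rintro q (rfl | hq)
    · exact ⟨p, hp, m, rfl, rfl⟩
    · exact ⟨q, hq, 0, by simp, by simp⟩
  refine ⟨hS.finite.insert _, fun q hq r hr n => ?_⟩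
  obtain ⟨q', hq', k, hk₁, hk₂⟩ := translate q hq
  obtain ⟨r', hr', l, hl₁, hl₂⟩ := translate r hr
  have := hS.eq_smul_iff q' hq' r' hr' (-l + (n + k))
  rw [hk₁, hk₂, hl₁, hl₂]
  simpa only [zpow_add, mul_smul, zpow_neg, eq_inv_smul_iff] using this

variable [IsCancelSMul H L] [IsCancelSMul K R]

lemma exists_mem_dom [Infinite (MulAction.orbitRel.Quotient K R)]
    (hcd : ∀ n : ℤ, c ^ n = 1 ↔ d ^ n = 1) (hS : IsFiniteMatching c d S) (x : L) :
    ∃ T, S ⊆ T ∧ IsFiniteMatching c d T ∧ ∃ y, (x, y) ∈ T := by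
  by_cases h : Unmet c (Prod.fst '' S) x
  · obtain ⟨y, hy⟩ := exists_fresh (H := K) (hS.finite.image Prod.snd)
    exact ⟨_, Set.subset_insert _ _, hS.insert_unmet hcd h (hy.unmet d), y, Set.mem_insert _ _⟩
  · obtain ⟨n, p, hp, hn⟩ := not_forall_not.1 h
    have := hS.insert_smul hp (-n)
    rw [hn, zpow_neg, inv_smul_smul] at this
    exact ⟨_, Set.subset_insert _ _, this, _, Set.mem_insert _ _⟩

lemma exists_mem_ran [Infinite (MulAction.orbitRel.Quotient H L)]
    (hcd : ∀ n : ℤ, c ^ n = 1 ↔ d ^ n = 1) (hS : IsFiniteMatching c d S) (y : R) :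
    ∃ T, S ⊆ T ∧ IsFiniteMatching c d T ∧ ∃ x, (x, y) ∈ T := by
  obtain ⟨T, hST, hT, x, hx⟩ := hS.swap.exists_mem_dom (fun n => (hcd n).symm) y
  refine ⟨Prod.swap '' T, ?_, hT.swap, x, _, hx, rfl⟩
  rw [Set.image_swap_eq_preimage_swap]
  exact Set.image_subset_iff.1 hST

variable [Infinite (MulAction.orbitRel.Quotient K R)]

lemma exists_connect (hcd : ∀ n : ℤ, c ^ n = 1 ↔ d ^ n = 1) (hS : IsFiniteMatching c d S) {x y : L}
    (hx : Unmet c (Prod.fst '' S) x) (hy : Unmet c (Prod.fst '' S) y)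
    (hxy : ∀ n : ℤ, c ^ n • y ≠ x) {r : K} (hr : r ∉ Subgroup.zpowers d) :
    ∃ u, IsFiniteMatching c d (insert (y, r • u) (insert (x, u) S)) := by
  obtain ⟨u, hu⟩ := exists_fresh (H := K) (hS.finite.image Prod.snd)
  refine ⟨u, (hS.insert_unmet hcd hx (hu.unmet d)).insert_unmet hcd ?_ ?_⟩ <;>
    rw [Set.image_insert_eq]
  · exact hy.insert hxy
  · exact (hu.meetsByPowers_insert d).unmet_smul hr

variable [Infinite (MulAction.orbitRel.Quotient H L)]

lemma exists_letter (hcd : ∀ n : ℤ, c ^ n = 1 ↔ d ^ n = 1) (hS : IsFiniteMatching c d S) {x : L}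
    (hx : Unmet c (Prod.fst '' S) x) {r : K} (hr : r ∉ Subgroup.zpowers d) {O : Set L}
    (hO : O.Finite) :
    ∃ T, S ⊆ T ∧ IsFiniteMatching c d T ∧ ∃ u y, (x, u) ∈ T ∧ (y, r • u) ∈ T ∧ Fresh H O y ∧
      MeetsByPowers c (Prod.fst '' T) y := by
  obtain ⟨y, hy⟩ := exists_fresh (H := H) (((hS.finite.image Prod.fst).insert x).union hO)
  have hyx : Fresh H (insert x (Prod.fst '' S)) y := hy.mono Set.subset_union_left
  obtain ⟨u, hT⟩ := hS.exists_connect hcd hx ((hyx.unmet c).mono (Set.subset_insert _ _))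
    (fun n hn => hyx (c ^ n) (Or.inl hn)) hr
  refine ⟨_, (Set.subset_insert _ _).trans (Set.subset_insert _ _), hT, u, y, by simp, by simp,
    hy.mono Set.subset_union_right, ?_⟩
  rw [Set.image_insert_eq, Set.image_insert_eq]
  exact hyx.meetsByPowers_insert c

end IsFiniteMatching

/-- A word none of whose letters lies in the amalgamated subgroups `⟨c⟩` and `⟨d⟩`. -/
def ReducedWord (c : H) (d : K) (ps : List (H × K)) : Prop :=
  ∀ p ∈ ps, p.1 ∉ Subgroup.zpowers c ∧ p.2 ∉ Subgroup.zpowers d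

lemma reducedWord_cons {p : H × K} {ps : List (H × K)} :
    ReducedWord c d (p :: ps) ↔
      (p.1 ∉ Subgroup.zpowers c ∧ p.2 ∉ Subgroup.zpowers d) ∧ ReducedWord c d ps :=
  List.forall_mem_cons

/-- The action of a word on `L`, with `K` acting through `t`; the head of the list acts first. -/
def wordSMul (t : L ≃ R) : List (H × K) → L → L
  | [], x => x
  | p :: ps, x => wordSMul t ps (t.symm (p.2 • t (p.1 • x)))

/-- `Run S ps x x'` says that the pairs in `S` suffice to compute that `ps` carries `x` to `x'`. -/
def Run (S : Set (L × R)) : List (H × K) → L → L → Prop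
  | [], x, x' => x = x'
  | p :: ps, x, x' => ∃ u y, (p.1 • x, u) ∈ S ∧ (y, p.2 • u) ∈ S ∧ Run S ps y x'

lemma symm_smul_apply_eq {t : L ≃ R} (hS : ∀ p ∈ S, t p.1 = p.2) {x y : L} {u : R} {r : K}
    (hx : (x, u) ∈ S) (hy : (y, r • u) ∈ S) : t.symm (r • t x) = y := by
  rw [hS _ hx, Equiv.symm_apply_eq]
  exact (hS _ hy).symm

lemma Run.wordSMul_eq {t : L ≃ R} (hS : ∀ p ∈ S, t p.1 = p.2) {ps : List (H × K)} {x x' : L}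
    (h : Run S ps x x') : wordSMul t ps x = x' := by
  induction ps generalizing x with
  | nil => exact h
  | cons p ps ih =>
    obtain ⟨u, y, hxu, hyu, hrun⟩ := h
    rw [wordSMul, symm_smul_apply_eq hS hxu hyu, ih hrun]

section Extension

variable [IsCancelSMul H L] [IsCancelSMul K R] [Infinite (MulAction.orbitRel.Quotient H L)]
  [Infinite (MulAction.orbitRel.Quotient K R)]

lemma IsFiniteMatching.exists_run (hcd : ∀ n : ℤ, c ^ n = 1 ↔ d ^ n = 1)
    (hS : IsFiniteMatching c d S) {ps : List (H × K)} (hps : ReducedWord c d ps) {O : Set L}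
    (hO : O.Finite) {x : L} (hx : MeetsByPowers c (Prod.fst '' S) x) :
    ∃ T, S ⊆ T ∧ IsFiniteMatching c d T ∧ ∃ x', Run T ps x x' ∧
      (Fresh H O x ∨ ps ≠ [] → Fresh H O x') := by
  induction ps generalizing S x with
  | nil => exact ⟨S, subset_rfl, hS, x, rfl, by simp⟩
  | cons p ps ih =>
    obtain ⟨⟨hp₁, hp₂⟩, hps⟩ := reducedWord_cons.1 hps
    obtain ⟨S', hSS', hS', u, y, hxu, hyu, hyO, hy⟩ :=
      hS.exists_letter hcd (hx.unmet_smul hp₁) hp₂ hO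
    obtain ⟨T, hS'T, hT, x', hrun, hx'⟩ := ih hS' hps hy
    exact ⟨T, hSS'.trans hS'T, hT, x', ⟨u, y, hS'T hxu, hS'T hyu, hrun⟩, fun _ => hx' (Or.inl hyO)⟩

lemma IsFiniteMatching.exists_moved (hcd : ∀ n : ℤ, c ^ n = 1 ↔ d ^ n = 1)
    (hS : IsFiniteMatching c d S) (l : H) {ps : List (H × K)} (hps : ReducedWord c d ps) (r : K)
    (hne : ¬(ps = [] ∧ r ∈ Subgroup.zpowers d)) :
    ∃ T, S ⊆ T ∧ IsFiniteMatching c d T ∧ ∃ x u y x', (x, u) ∈ T ∧ (y, r • u) ∈ T ∧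
      Run T ps y x' ∧ l • x' ≠ x := by
  obtain ⟨x, hx⟩ := exists_fresh (H := H) (hS.finite.image Prod.fst)
  have hO := Set.finite_singleton x
  by_cases hr : r ∈ Subgroup.zpowers d
  · obtain ⟨n, rfl⟩ := hr
    obtain ⟨u, hu⟩ := exists_fresh (H := K) (hS.finite.image Prod.snd)
    have hxu : IsFiniteMatching c d (insert (c ^ n • x, d ^ n • u) (insert (x, u) S)) :=
      (hS.insert_unmet hcd (hx.unmet c) (hu.unmet d)).insert_smul (Set.mem_insert _ _) n
    have hcx : MeetsByPowers c (Prod.fst '' insert (c ^ n • x, d ^ n • u) (insert (x, u) S))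
        (c ^ n • x) := by
      rw [Set.image_insert_eq, Set.image_insert_eq]
      exact ((hx.meetsByPowers_insert c).insert_zpow_smul n).zpow_smul n
    obtain ⟨T, hST, hT, x', hrun, hx'⟩ := hxu.exists_run hcd hps hO hcx
    exact ⟨T, fun p hp => hST (by simp [hp]), hT, x, u, _, x', hST (by simp), hST (by simp), hrun,
      hx' (Or.inr fun h => hne ⟨h, n, rfl⟩) l⟩
  · obtain ⟨S', hSS', hS', u, y, hxu, hyu, hyO, hy⟩ := hS.exists_letter hcd (hx.unmet c) hr hO
    obtain ⟨T, hS'T, hT, x', hrun, hx'⟩ := hS'.exists_run hcd hps hO hy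
    exact ⟨T, hSS'.trans hS'T, hT, x, u, y, x', hS'T hxu, hS'T hyu, hrun, hx' (Or.inl hyO) l⟩

end Extension

/-- The conjugates of `⟨c⟩` by the nonzero powers of `a` meet `⟨c⟩` trivially. -/
def PowerSeparated (c a : H) : Prop :=
  ∀ i n m : ℤ, a ^ i * c ^ n * a ^ (-i) = c ^ m → i = 0 ∨ n = 0

namespace PowerSeparated

lemma zpow_eq_one_iff (h : PowerSeparated c a) {n : ℤ} : c ^ n = 1 ↔ n = 0 := by
  refine ⟨fun hn => ?_, fun hn => by rw [hn, zpow_zero]⟩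
  exact (h 1 n 0 (by simp [hn])).resolve_left one_ne_zero

lemma eq_zero_of_zpow_eq (h : PowerSeparated c a) {i n : ℤ} (hn : a ^ i = c ^ n) : i = 0 := by
  refine (h i 1 1 ?_).resolve_right one_ne_zero
  rw [zpow_neg, hn, ← zpow_add, add_comm, zpow_add, mul_inv_cancel_right]

lemma notMem_zpowers (h : PowerSeparated c a) : a ∉ Subgroup.zpowers c := by
  rintro ⟨n, hn⟩
  exact one_ne_zero (h.eq_zero_of_zpow_eq (i := 1) (n := n) (by rw [zpow_one]; exact hn.symm))

variable [IsCancelSMul H L]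

lemma subsingleton_met (h : PowerSeparated c a) (x z : L) :
    {N : ℤ | ∃ n : ℤ, c ^ n • a ^ N • x = z}.Subsingleton := by
  rintro N ⟨n, hn⟩ M ⟨m, hm⟩
  have hmul : c ^ n * a ^ N = c ^ m * a ^ M :=
    IsCancelSMul.right_cancel _ _ x (by rw [mul_smul, mul_smul, hn, hm])
  have hpow : a ^ (N - M) = c ^ (m - n) := by
    calc a ^ (N - M) = c ^ (-n) * (c ^ n * a ^ N) * a ^ (-M) := by group
      _ = c ^ (m - n) := by rw [hmul]; group
  exact sub_eq_zero.1 (h.eq_zero_of_zpow_eq hpow)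

lemma subsingleton_joined (h : PowerSeparated c a) {x y : L} (hxy : x ≠ y) :
    {N : ℤ | ∃ n : ℤ, c ^ n • a ^ N • x = a ^ N • y}.Subsingleton := by
  rintro N ⟨n, hn⟩ M ⟨m, hm⟩
  have hconj : a ^ (-N) * c ^ n * a ^ N = a ^ (-M) * c ^ m * a ^ M :=
    IsCancelSMul.right_cancel _ _ x (by simp only [mul_smul, hn, hm, zpow_neg, inv_smul_smul])
  have hpow : a ^ (M - N) * c ^ n * a ^ (-(M - N)) = c ^ m := by
    calc a ^ (M - N) * c ^ n * a ^ (-(M - N)) = a ^ M * (a ^ (-N) * c ^ n * a ^ N) * a ^ (-M) := by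
          group
      _ = c ^ m := by rw [hconj]; group
  rcases h _ _ _ hpow with h | rfl
  · exact (sub_eq_zero.1 h).symm
  · rw [zpow_zero, one_smul] at hn
    exact absurd (smul_left_cancel _ hn) hxy

/-- All but finitely many powers of `a` have the required property. -/
lemma exists_smul_unmet (h : PowerSeparated c a) {ι : Type*} [Finite ι] (x : ι ↪ L) {O : Set L}
    (hO : O.Finite) :
    ∃ f : H, (∀ i, Unmet c O (f • x i)) ∧
      Pairwise fun i j => ∀ n : ℤ, c ^ n • f • x i ≠ f • x j := by
  have hmet : (⋃ i, ⋃ z ∈ O, {N : ℤ | ∃ n : ℤ, c ^ n • a ^ N • x i = z}).Finite :=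
    Set.finite_iUnion fun i => hO.biUnion fun z _ => (h.subsingleton_met (x i) z).finite
  have hjoined :
      (⋃ i, ⋃ j ∈ {j | i ≠ j}, {N : ℤ | ∃ n : ℤ, c ^ n • a ^ N • x i = a ^ N • x j}).Finite :=
    Set.finite_iUnion fun i => (Set.toFinite _).biUnion fun j hij =>
      (h.subsingleton_joined (x.injective.ne hij)).finite
  obtain ⟨N, hN⟩ := (hmet.union hjoined).infinite_compl.nonempty
  simp only [Set.mem_compl_iff, Set.mem_union, Set.mem_iUnion, Set.mem_ofPred_eq, not_or,
    not_exists] at hN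
  exact ⟨a ^ N, fun i n hn => hN.1 i _ hn n rfl, fun i j hij n hn => hN.2 i j hij n hn⟩

end PowerSeparated

section Extension

variable [IsCancelSMul H L] [IsCancelSMul K R] [Infinite (MulAction.orbitRel.Quotient K R)]

lemma IsFiniteMatching.exists_family (hcd : ∀ n : ℤ, c ^ n = 1 ↔ d ^ n = 1)
    (hS : IsFiniteMatching c d S) {r : K} (hr : r ∉ Subgroup.zpowers d) {ι : Type*} [Finite ι]
    (z : ι ⊕ ι → L) (hz : ∀ i, Unmet c (Prod.fst '' S) (z i))
    (hzz : Pairwise fun i j => ∀ n : ℤ, c ^ n • z i ≠ z j) :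
    ∃ T, S ⊆ T ∧ IsFiniteMatching c d T ∧
      ∀ i, ∃ u, (z (.inl i), u) ∈ T ∧ (z (.inr i), r • u) ∈ T := by
  have := Fintype.ofFinite ι
  suffices h : ∀ s : Finset ι, ∃ T, S ⊆ T ∧ IsFiniteMatching c d T ∧
      (∀ i ∈ s, ∃ u, (z (.inl i), u) ∈ T ∧ (z (.inr i), r • u) ∈ T) ∧
      ∀ i ∉ s, Unmet c (Prod.fst '' T) (z (.inl i)) ∧ Unmet c (Prod.fst '' T) (z (.inr i)) by
    obtain ⟨T, hST, hT, hsT, -⟩ := h Finset.univ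
    exact ⟨T, hST, hT, fun i => hsT i (Finset.mem_univ i)⟩
  intro s
  induction s using Finset.cons_induction with
  | empty => exact ⟨S, subset_rfl, hS, by simp, fun i _ => ⟨hz _, hz _⟩⟩
  | cons i s his ih =>
    obtain ⟨T, hST, hT, hin, hout⟩ := ih
    obtain ⟨u, hU⟩ := hT.exists_connect hcd (hout i his).1 (hout i his).2 (hzz (by simp)) hr
    refine ⟨_, hST.trans ((Set.subset_insert _ _).trans (Set.subset_insert _ _)), hU,
      fun j hj => ?_, fun j hj => ?_⟩
    · rcases Finset.mem_cons.1 hj with rfl | hj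
      · exact ⟨u, by simp, by simp⟩
      · obtain ⟨v, hv, hv'⟩ := hin j hj
        exact ⟨v, by simp [hv], by simp [hv']⟩
    · obtain ⟨hji, hj⟩ := not_or.1 (mt Finset.mem_cons.2 hj)
      rw [Set.image_insert_eq, Set.image_insert_eq]
      exact ⟨((hout j hj).1.insert (hzz (by simp [hji]))).insert (hzz (by simp)),
        ((hout j hj).2.insert (hzz (by simp))).insert (hzz (by simp [hji]))⟩

lemma IsFiniteMatching.exists_tuple (hcd : ∀ n : ℤ, c ^ n = 1 ↔ d ^ n = 1)
    (hca : PowerSeparated c a) {r : K} (hr : r ∉ Subgroup.zpowers d)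
    (hS : IsFiniteMatching c d S) {ι : Type*} [Finite ι] (x y : ι ↪ L) :
    ∃ T, S ⊆ T ∧ IsFiniteMatching c d T ∧ ∃ f f' : H, ∀ i, ∃ u,
      (f • x i, u) ∈ T ∧ (f' • y i, r • u) ∈ T := by
  have hdom := hS.finite.image Prod.fst
  obtain ⟨f, hf, hff⟩ := hca.exists_smul_unmet x hdom
  obtain ⟨f', hf', hff'⟩ := hca.exists_smul_unmet y (hdom.union (Set.finite_range fun i => f • x i))
  have hxy (i j : ι) (n : ℤ) : c ^ n • f' • y i ≠ f • x j :=
    fun h => hf' i n (Or.inr ⟨j, h.symm⟩)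
  obtain ⟨T, hST, hT, h⟩ := hS.exists_family hcd hr (Sum.elim (fun i => f • x i) fun i => f' • y i)
    (Sum.forall.2 ⟨hf, fun i => (hf' i).mono Set.subset_union_left⟩) (by
      rintro (i | i) (j | j) hij n
      · exact hff (by simpa using hij) n
      · intro h
        exact hxy j i (-n) (by rw [zpow_neg, inv_smul_eq_iff]; exact h.symm)
      · exact hxy i j n
      · exact hff' (by simpa using hij) n)
  exact ⟨T, hST, hT, f, f', h⟩

end Extension

section Generic

lemma exists_equiv_of_ideal (J : Order.Ideal {S : Set (L × R) // IsFiniteMatching c d S})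
    (hdom : ∀ x, ∃ S ∈ J, ∃ y, (x, y) ∈ S.1) (hran : ∀ y, ∃ S ∈ J, ∃ x, (x, y) ∈ S.1) :
    ∃ t : L ≃ R, (∀ x, t (c • x) = d • t x) ∧ ∀ S ∈ J, ∀ p ∈ S.1, t p.1 = p.2 := by
  have hJ : ∀ S ∈ J, ∀ S' ∈ J, ∀ p ∈ S.1, ∀ q ∈ S'.1, ∀ n : ℤ,
      q.1 = c ^ n • p.1 ↔ q.2 = d ^ n • p.2 := fun S hS S' hS' p hp q hq n => by
    obtain ⟨T, -, hST, hS'T⟩ := J.directed S hS S' hS'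
    exact T.2.eq_smul_iff p (hST hp) q (hS'T hq) n
  have hJ₀ : ∀ S ∈ J, ∀ S' ∈ J, ∀ p ∈ S.1, ∀ q ∈ S'.1, q.1 = p.1 ↔ q.2 = p.2 :=
    fun S hS S' hS' p hp q hq => by simpa using hJ S hS S' hS' p hp q hq 0
  choose D hD t ht using hdom
  choose E hE s hs using hran
  refine ⟨⟨t, s, fun x => ?_, fun y => ?_⟩, fun x => ?_, fun S hS p hp => ?_⟩
  · exact (hJ₀ _ (hD x) _ (hE _) _ (ht x) _ (hs _)).2 rfl
  · exact (hJ₀ _ (hE y) _ (hD _) _ (hs y) _ (ht _)).1 rfl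
  · simpa using hJ _ (hD x) _ (hD (c • x)) _ (ht x) _ (ht _) 1
  · exact (hJ₀ _ hS _ (hD p.1) _ hp _ (ht _)).1 rfl

variable [IsCancelSMul H L] [IsCancelSMul K R] [Infinite (MulAction.orbitRel.Quotient H L)]
  [Infinite (MulAction.orbitRel.Quotient K R)]

lemma exists_equiv_forall_exists [Countable L] [Countable R]
    (hcd : ∀ n : ℤ, c ^ n = 1 ↔ d ^ n = 1) {I : Type*} [Countable I]
    (P : I → Set (L × R) → Prop)
    (hP : ∀ i S, IsFiniteMatching c d S → ∃ T, S ⊆ T ∧ IsFiniteMatching c d T ∧ P i T) :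
    ∃ t : L ≃ R, (∀ x, t (c • x) = d • t x) ∧ ∀ i, ∃ S, P i S ∧ ∀ p ∈ S, t p.1 = p.2 := by
  have := Encodable.ofCountable (L ⊕ R ⊕ I)
  let P' : L ⊕ R ⊕ I → Set (L × R) → Prop :=
    Sum.elim (fun x S => ∃ y, (x, y) ∈ S) (Sum.elim (fun y S => ∃ x, (x, y) ∈ S) P)
  have hP' : ∀ i S, IsFiniteMatching c d S → ∃ T, S ⊆ T ∧ IsFiniteMatching c d T ∧ P' i T := by
    rintro (x | y | i) S hS
    · exact hS.exists_mem_dom hcd x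
    · exact hS.exists_mem_ran hcd y
    · exact hP i S hS
  let D (i : L ⊕ R ⊕ I) : Order.Cofinal {S : Set (L × R) // IsFiniteMatching c d S} :=
    ⟨{S | P' i S.1}, fun S => by
      obtain ⟨T, hST, hT, hPT⟩ := hP' i S.1 S.2
      exact ⟨⟨T, hT⟩, hPT, hST⟩⟩
  let J := Order.idealOfCofinals ⟨∅, .empty c d⟩ D
  have hJ (i : L ⊕ R ⊕ I) : ∃ S ∈ J, P' i S.1 := by
    obtain ⟨S, hiS, hS⟩ := Order.cofinal_meets_idealOfCofinals ⟨∅, .empty c d⟩ D i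
    exact ⟨S, hS, hiS⟩
  obtain ⟨t, ht, htJ⟩ :=
    exists_equiv_of_ideal J (fun x => hJ (.inl x)) fun y => hJ (.inr (.inl y))
  refine ⟨t, ht, fun i => ?_⟩
  obtain ⟨S, hS, hiS⟩ := hJ (.inr (.inr i))
  exact ⟨S, hiS, htJ S hS⟩

theorem exists_generic_equiv [Countable H] [Countable K] [Countable L] [Countable R]
    (hcd : ∀ n : ℤ, c ^ n = 1 ↔ d ^ n = 1) (hca : PowerSeparated c a)
    {b : K} (hb : b ∉ Subgroup.zpowers d) :
    ∃ t : L ≃ R, (∀ x, t (c • x) = d • t x) ∧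
      (∀ (l : H) (ps : List (H × K)) (r : K), ReducedWord c d ps →
        ¬(ps = [] ∧ r ∈ Subgroup.zpowers d) →
        ∃ x, l • wordSMul t ps (t.symm (r • t x)) ≠ x) ∧
      ∀ (k : ℕ) (x y : Fin k ↪ L), ∃ f f' : H, ∀ i, t.symm (b • t (f • x i)) = f' • y i := by
  have hword : ∀ w : {w : H × List (H × K) × K //
      ReducedWord c d w.2.1 ∧ ¬(w.2.1 = [] ∧ w.2.2 ∈ Subgroup.zpowers d)}, ∀ S : Set (L × R),
      IsFiniteMatching c d S → ∃ T, S ⊆ T ∧ IsFiniteMatching c d T ∧ ∃ x u y x', (x, u) ∈ T ∧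
        (y, w.1.2.2 • u) ∈ T ∧ Run T w.1.2.1 y x' ∧ w.1.1 • x' ≠ x :=
    fun w S hS => hS.exists_moved hcd _ w.2.1 _ w.2.2
  have htuple : ∀ xy : Σ k : ℕ, (Fin k ↪ L) × (Fin k ↪ L), ∀ S : Set (L × R),
      IsFiniteMatching c d S → ∃ T, S ⊆ T ∧ IsFiniteMatching c d T ∧ ∃ f f' : H, ∀ i, ∃ u,
        (f • xy.2.1 i, u) ∈ T ∧ (f' • xy.2.2 i, b • u) ∈ T :=
    fun xy S hS => hS.exists_tuple hcd hca hb xy.2.1 xy.2.2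
  have (k : ℕ) : Countable (Fin k ↪ L) := DFunLike.coe_injective.countable
  obtain ⟨t, ht, h⟩ := exists_equiv_forall_exists hcd (Sum.elim _ _) (Sum.forall.2 ⟨hword, htuple⟩)
  refine ⟨t, ht, fun l ps r hps hne => ?_, fun k x y => ?_⟩
  · obtain ⟨S, ⟨x, u, y, x', hxu, hyu, hrun, hx'⟩, hS⟩ := h (.inl ⟨(l, ps, r), hps, hne⟩)
    exact ⟨x, by rwa [symm_smul_apply_eq hS hxu hyu, hrun.wordSMul_eq hS]⟩
  · obtain ⟨S, ⟨f, f', hS'⟩, hS⟩ := h (.inr ⟨k, x, y⟩)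
    refine ⟨f, f', fun i => ?_⟩
    obtain ⟨u, hxu, hyu⟩ := hS' i
    exact symm_smul_apply_eq hS hxu hyu

end Generic

end Matching

/-! ### Amalgams -/

section Amalgam

variable {H K Γ : Type*} [Group H] [Group K] [Group Γ] {φ : H →* Γ} {ψ : K →* Γ} {c : H} {d : K}

/-- The value of a word in a group; the head of the list is the rightmost factor. -/
def wordProd (φ : H →* Γ) (ψ : K →* Γ) : List (H × K) → Γ
  | [] => 1
  | p :: ps => wordProd φ ψ ps * (ψ p.2 * φ p.1)

/-- The element `γ` is the value of a reduced word, with arbitrary letters `l` and `r` attached to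
its two ends. -/
def HasReducedForm (φ : H →* Γ) (ψ : K →* Γ) (c : H) (d : K) (γ : Γ) : Prop :=
  ∃ (l : H) (ps : List (H × K)) (r : K), ReducedWord c d ps ∧ γ = φ l * wordProd φ ψ ps * ψ r

lemma hasReducedForm_one : HasReducedForm φ ψ c d 1 :=
  ⟨1, [], 1, by simp [ReducedWord], by simp [wordProd]⟩

lemma HasReducedForm.mul_map_right {γ : Γ} (hγ : HasReducedForm φ ψ c d γ) (k : K) :
    HasReducedForm φ ψ c d (γ * ψ k) := by
  obtain ⟨l, ps, r, hps, rfl⟩ := hγ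
  exact ⟨l, ps, r * k, hps, by rw [map_mul, mul_assoc]⟩

lemma map_zpow_eq_map_zpow (hcd : φ c = ψ d) (n : ℤ) : φ (c ^ n) = ψ (d ^ n) := by
  rw [map_zpow, map_zpow, hcd]

lemma hasReducedForm_mul_wordProd_mul (hcd : φ c = ψ d) (l : H) {ps : List (H × K)}
    (hps : ReducedWord c d ps) (h : H) : HasReducedForm φ ψ c d (φ l * wordProd φ ψ ps * φ h) := by
  cases ps with
  | nil => exact ⟨l * h, [], 1, hps, by simp [wordProd]⟩
  | cons p ps =>
    obtain ⟨hp, hps⟩ := reducedWord_cons.1 hps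
    by_cases hl : p.1 * h ∈ Subgroup.zpowers c
    · obtain ⟨m, hm⟩ := Subgroup.mem_zpowers_iff.1 hl
      refine ⟨l, ps, p.2 * d ^ m, hps, ?_⟩
      rw [wordProd, map_mul ψ, ← map_zpow_eq_map_zpow hcd, hm, map_mul]
      simp only [mul_assoc]
    · refine ⟨l, (p.1 * h, p.2) :: ps, 1, reducedWord_cons.2 ⟨⟨hl, hp.2⟩, hps⟩, ?_⟩
      simp only [wordProd, map_mul, mul_assoc, map_one, mul_one]

lemma HasReducedForm.mul_map_left (hcd : φ c = ψ d) {γ : Γ} (hγ : HasReducedForm φ ψ c d γ)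
    (h : H) : HasReducedForm φ ψ c d (γ * φ h) := by
  obtain ⟨l, ps, r, hps, rfl⟩ := hγ
  by_cases hr : r ∈ Subgroup.zpowers d
  · obtain ⟨n, rfl⟩ := hr
    have := hasReducedForm_mul_wordProd_mul hcd l hps (c ^ n * h)
    rwa [map_mul, map_zpow_eq_map_zpow hcd, ← mul_assoc] at this
  · by_cases hh : h ∈ Subgroup.zpowers c
    · obtain ⟨n, rfl⟩ := hh
      exact ⟨l, ps, r * d ^ n, hps, by
        rw [map_mul, ← map_zpow_eq_map_zpow hcd, mul_assoc (φ l * _)]⟩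
    · refine ⟨l, (h, r) :: ps, 1, reducedWord_cons.2 ⟨⟨hh, hr⟩, hps⟩, ?_⟩
      simp only [wordProd, mul_assoc, map_one, mul_one]

lemma hasReducedForm_of_mem_sup (hcd : φ c = ψ d) {γ : Γ} (hγ : γ ∈ φ.range ⊔ ψ.range) :
    HasReducedForm φ ψ c d γ := by
  rw [Subgroup.sup_eq_closure] at hγ
  induction hγ using Subgroup.closure_induction_right with
  | one => exact hasReducedForm_one
  | mul_right γ _ x hx ih =>
    rcases hx with ⟨h, rfl⟩ | ⟨k, rfl⟩
    · exact ih.mul_map_left hcd h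
    · exact ih.mul_map_right k
  | mul_inv_cancel γ _ x hx ih =>
    rcases hx with ⟨h, rfl⟩ | ⟨k, rfl⟩
    · rw [← map_inv]
      exact ih.mul_map_left hcd h⁻¹
    · rw [← map_inv]
      exact ih.mul_map_right k⁻¹

/-- The homomorphisms `φ` and `ψ` present `Γ` as the amalgam of `H` and `K` along `c = d`. The
universal property is only required for homomorphisms into groups of permutations. -/
structure IsAmalgam (φ : H →* Γ) (ψ : K →* Γ) (c : H) (d : K) : Prop where
  map_eq_map : φ c = ψ d
  sup_range_eq_top : φ.range ⊔ ψ.range = ⊤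
  exists_lift : ∀ (Y : Type) (ρ : H →* Equiv.Perm Y) (σ : K →* Equiv.Perm Y), ρ c = σ d →
    ∃ θ : Γ →* Equiv.Perm Y, θ.comp φ = ρ ∧ θ.comp ψ = σ

lemma apply_wordProd {L R : Type*} [MulAction H L] [MulAction K R] {t : L ≃ R}
    {θ : Γ →* Equiv.Perm L} (hφ : ∀ h x, θ (φ h) x = h • x)
    (hψ : ∀ k x, θ (ψ k) x = t.symm (k • t x)) (ps : List (H × K)) (x : L) :
    θ (wordProd φ ψ ps) x = wordSMul t ps x := by
  induction ps generalizing x with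
  | nil => simp only [wordProd, wordSMul, map_one, Equiv.Perm.one_apply]
  | cons p ps ih =>
    rw [wordProd, map_mul, map_mul, Equiv.Perm.mul_apply, Equiv.Perm.mul_apply, ih, hφ, hψ,
      wordSMul]

lemma IsAmalgam.injective_of_moved {L R : Type*} [MulAction H L] [MulAction K R] [Nonempty L]
    [IsCancelSMul H L] (hΓ : IsAmalgam φ ψ c d) {t : L ≃ R} {θ : Γ →* Equiv.Perm L}
    (hφ : ∀ h x, θ (φ h) x = h • x) (hψ : ∀ k x, θ (ψ k) x = t.symm (k • t x))
    (hmoved : ∀ (l : H) (ps : List (H × K)) (r : K), ReducedWord c d ps →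
      ¬(ps = [] ∧ r ∈ Subgroup.zpowers d) → ∃ x, l • wordSMul t ps (t.symm (r • t x)) ≠ x) :
    Function.Injective θ := by
  refine (injective_iff_map_eq_one θ).2 fun γ hγ => ?_
  obtain ⟨l, ps, r, hps, rfl⟩ :=
    hasReducedForm_of_mem_sup hΓ.map_eq_map (hΓ.sup_range_eq_top ▸ Subgroup.mem_top γ)
  by_cases hne : ps = [] ∧ r ∈ Subgroup.zpowers d
  · obtain ⟨rfl, n, rfl⟩ := hne
    have heq : φ l * wordProd φ ψ [] * ψ (d ^ n) = φ (l * c ^ n) := by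
      rw [wordProd, mul_one, map_mul, map_zpow_eq_map_zpow hΓ.map_eq_map]
    obtain ⟨x⟩ := ‹Nonempty L›
    have hone : l * c ^ n = 1 :=
      IsCancelSMul.eq_one_of_smul (x := x) (by rw [← hφ, ← heq, hγ, Equiv.Perm.one_apply])
    rw [heq, hone, map_one]
  · obtain ⟨x, hx⟩ := hmoved l ps r hps hne
    refine absurd ?_ hx
    rw [← hψ, ← apply_wordProd hφ hψ, ← hφ, ← Equiv.Perm.mul_apply, ← Equiv.Perm.mul_apply,
      ← map_mul, ← map_mul, hγ, Equiv.Perm.one_apply]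

end Amalgam

/-! ### Highly transitive actions -/

section HighlyTransitive

variable {Γ : Type*} [Group Γ]

/-- The group `Γ` has a faithful, highly transitive action on a countably infinite set. -/
def HasFaithfulHighlyTransitiveAction (Γ : Type*) [Group Γ] : Prop :=
  ∃ (Y : Type) (_ : Countable Y) (_ : Infinite Y) (_ : MulAction Γ Y),
    FaithfulSMul Γ Y ∧ IsHighlyTransitive Γ Y

lemma HasFaithfulHighlyTransitiveAction.of_hom {Y : Type} [Countable Y] [Infinite Y]
    (θ : Γ →* Equiv.Perm Y) (hθ : Function.Injective θ)
    (htrans : ∀ (k : ℕ) (x y : Fin k ↪ Y), ∃ γ, ∀ i, θ γ (x i) = y i) :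
    HasFaithfulHighlyTransitiveAction Γ := by
  let act : MulAction Γ Y := MulAction.compHom Y θ
  refine ⟨Y, inferInstance, inferInstance, act, ⟨fun h => hθ (Equiv.ext h)⟩,
    fun k => ⟨fun x y => ?_⟩⟩
  obtain ⟨γ, hγ⟩ := htrans k x y
  exact ⟨γ, DFunLike.ext _ _ hγ⟩

lemma HasFaithfulHighlyTransitiveAction.of_mulEquiv {N : Type*} [Group N] (e : Γ ≃* N)
    (hN : HasFaithfulHighlyTransitiveAction N) : HasFaithfulHighlyTransitiveAction Γ := by
  obtain ⟨Y, _, _, _, _, htrans⟩ := hN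
  refine .of_hom ((MulAction.toPermHom N Y).comp e)
    ((MulAction.toPerm_injective (α := N) (β := Y)).comp e.injective) fun k x y => ?_
  obtain ⟨n, hn⟩ := (htrans k).exists_smul_eq x y
  refine ⟨e.symm n, fun i => ?_⟩
  rw [MonoidHom.comp_apply, MonoidHom.coe_coe, e.apply_symm_apply]
  exact DFunLike.congr_fun hn i

lemma dense_of_isHighlyTransitive {G : Subgroup (Equiv.Perm ℤ)} (hG : IsHighlyTransitive G ℤ) :
    Dense (G : Set (Equiv.Perm ℤ)) := by
  intro σ
  rw [mem_closure_iff_nhds, nhds_induced]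
  rintro t ⟨u, hu, hut⟩
  rw [nhds_pi, Filter.mem_pi] at hu
  obtain ⟨I, hI, s, hs, hsu⟩ := hu
  have := hI.fintype
  let f : Fin (Fintype.card I) ↪ ℤ :=
    (Fintype.equivFin I).symm.toEmbedding.trans (Function.Embedding.subtype _)
  obtain ⟨γ, hγ⟩ := (hG _).exists_smul_eq f (f.trans σ.toEmbedding)
  refine ⟨γ, hut (hsu fun i hi => ?_), γ.2⟩
  have hγi : (γ : Equiv.Perm ℤ) i = σ i := by
    simpa [f, Subgroup.smul_def] using DFunLike.congr_fun hγ (Fintype.equivFin I ⟨i, hi⟩)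
  change (γ : Equiv.Perm ℤ) i ∈ s i
  rw [hγi]
  exact mem_of_mem_nhds (hs i)

lemma HasFaithfulHighlyTransitiveAction.exists_dense_subgroup
    (hΓ : HasFaithfulHighlyTransitiveAction Γ) :
    ∃ G : Subgroup (Equiv.Perm ℤ), Dense (G : Set (Equiv.Perm ℤ)) ∧ Nonempty (G ≃* Γ) := by
  obtain ⟨Y, _, _, _, _, htrans⟩ := hΓ
  obtain ⟨e⟩ : Nonempty (Y ≃ ℤ) := nonempty_equiv_of_countable
  let τ : Γ →* Equiv.Perm ℤ := (e.permCongrHom : Equiv.Perm Y →* Equiv.Perm ℤ).comp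
    (MulAction.toPermHom Γ Y)
  have hτ : Function.Injective τ := e.permCongrHom.injective.comp MulAction.toPerm_injective
  refine ⟨τ.range, dense_of_isHighlyTransitive fun k => ⟨fun x y => ?_⟩,
    ⟨(MonoidHom.ofInjective hτ).symm⟩⟩
  obtain ⟨γ, hγ⟩ := (htrans k).exists_smul_eq (x.trans e.symm.toEmbedding)
    (y.trans e.symm.toEmbedding)
  refine ⟨⟨τ γ, γ, rfl⟩, DFunLike.ext _ _ fun i => ?_⟩
  exact e.symm_apply_eq.1 (DFunLike.congr_fun hγ i).symm |>.symm

end HighlyTransitive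

section FreeActions

instance isCancelSMul_sigma {ι H L : Type*} [Group H] [MulAction H L] [IsCancelSMul H L] :
    IsCancelSMul H (Σ _ : ι, L) :=
  isCancelSMul_iff_eq_one_of_smul_eq.2 fun h ⟨i, x⟩ hx => by
    rw [Sigma.smul_mk, Sigma.mk.injEq, heq_iff_eq] at hx
    exact IsCancelSMul.eq_one_of_smul hx.2

instance infinite_orbitRel_quotient_sigma {ι H L : Type*} [Infinite ι] [Nonempty L] [Group H]
    [MulAction H L] : Infinite (MulAction.orbitRel.Quotient H (Σ _ : ι, L)) := by
  obtain ⟨x⟩ := ‹Nonempty L›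
  refine Infinite.of_injective (fun i : ι => Quotient.mk'' (⟨i, x⟩ : Σ _ : ι, L)) fun i j hij => ?_
  obtain ⟨h, hh⟩ := MulAction.orbitRel_apply.1 (Quotient.eq''.1 hij)
  exact congrArg Sigma.fst hh.symm

theorem IsAmalgam.hasFaithfulHighlyTransitiveAction {H K : Type} {Γ : Type*} [Group H] [Group K]
    [Group Γ] [Countable H] [Countable K] {φ : H →* Γ} {ψ : K →* Γ} {c a : H} {d b : K}
    (hΓ : IsAmalgam φ ψ c d) (hcd : ∀ n : ℤ, c ^ n = 1 ↔ d ^ n = 1) (hca : PowerSeparated c a)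
    (hb : b ∉ Subgroup.zpowers d) : HasFaithfulHighlyTransitiveAction Γ := by
  obtain ⟨t, ht, hmoved, htuple⟩ :=
    exists_generic_equiv (L := Σ _ : ℕ, H) (R := Σ _ : ℕ, K) hcd hca hb
  let ρ : H →* Equiv.Perm (Σ _ : ℕ, H) := MulAction.toPermHom H _
  let σ : K →* Equiv.Perm (Σ _ : ℕ, H) :=
    (t.symm.permCongrHom : Equiv.Perm (Σ _ : ℕ, K) →* _).comp (MulAction.toPermHom K _)
  have hρσ : ρ c = σ d := Equiv.ext fun x => (t.symm_apply_eq.2 (ht x).symm).symm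
  obtain ⟨θ, hθρ, hθσ⟩ := hΓ.exists_lift _ ρ σ hρσ
  have hφ (h : H) (x : Σ _ : ℕ, H) : θ (φ h) x = h • x := congr($hθρ h x)
  have hψ (k : K) (x : Σ _ : ℕ, H) : θ (ψ k) x = t.symm (k • t x) := congr($hθσ k x)
  refine .of_hom θ (hΓ.injective_of_moved hφ hψ hmoved) fun k x y => ?_
  obtain ⟨f, f', h⟩ := htuple k x y
  refine ⟨φ f'⁻¹ * ψ b * φ f, fun i => ?_⟩
  rw [map_mul, map_mul, Equiv.Perm.mul_apply, Equiv.Perm.mul_apply, hφ, hφ, hψ, h, inv_smul_smul]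

end FreeActions

/-! ### The surface relation -/

section SurfaceRelation

variable {G N : Type*} [Group G] [Group N]

/-- The commutator `β α⁻¹ β⁻¹ α`, the contribution of one handle to the surface relation. -/
def handle (α β : G) : G := β * α⁻¹ * β⁻¹ * α

/-- The product `handle (C 0 (n - 1)) (C 1 (n - 1)) * ⋯ * handle (C 0 0) (C 1 0)`; the two
generators of the `j`-th handle are `C 0 j` and `C 1 j`. -/
def handleProd (C : Fin 2 → ℕ → G) : ℕ → G
  | 0 => 1
  | n + 1 => handle (C 0 n) (C 1 n) * handleProd C n

lemma map_handle (f : G →* N) (α β : G) : f (handle α β) = handle (f α) (f β) := by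
  simp only [handle, map_mul, map_inv]

lemma handleProd_congr {C D : Fin 2 → ℕ → G} {n : ℕ} (h : ∀ r, ∀ j < n, C r j = D r j) :
    handleProd C n = handleProd D n := by
  induction n with
  | zero => rfl
  | succ n ih =>
    rw [handleProd, handleProd, h 0 n n.lt_succ_self, h 1 n n.lt_succ_self,
      ih fun r j hj => h r j (hj.trans n.lt_succ_self)]

lemma map_handleProd (f : G →* N) (C : Fin 2 → ℕ → G) (n : ℕ) :
    f (handleProd C n) = handleProd (fun r j => f (C r j)) n := by
  induction n with
  | zero => exact map_one f
  | succ n ih => rw [handleProd, map_mul, map_handle, ih, handleProd]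

lemma handleProd_succ' (C : Fin 2 → ℕ → G) (n : ℕ) :
    handleProd C (n + 1) =
      handleProd (fun r j => C r (j + 1)) n * handle (C 0 0) (C 1 0) := by
  induction n with
  | zero => rw [handleProd, handleProd, handleProd, mul_one, one_mul]
  | succ n ih => rw [handleProd, ih, handleProd, mul_assoc]

lemma PowerSeparated.of_map {c a : G} (f : G →* N) (h : PowerSeparated (f c) (f a)) :
    PowerSeparated c a := fun i n m e =>
  h i n m (by simpa only [map_mul, map_zpow] using congrArg f e)

lemma toPerm_zpow {M : Type*} [AddGroup M] (v : M) (n : ℤ) :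
    (AddAction.toPerm v : Equiv.Perm M) ^ n = AddAction.toPerm (n • v) :=
  (map_zsmul (AddAction.toPermHom M M) n v).symm

lemma handle_toPerm {R : Type*} [Ring R] (u : Rˣ) (v : R) :
    handle (MulAction.toPerm u) (AddAction.toPerm v : Equiv.Perm R) =
      AddAction.toPerm (v - ↑u⁻¹ * v) := by
  ext x
  change v + u⁻¹ • (-v + u • x) = v - ↑u⁻¹ * v + x
  rw [smul_add, inv_smul_smul, Units.smul_def, smul_eq_mul, mul_neg, sub_eq_add_neg, add_assoc]

/-- The commutator is a translation, and conjugating a translation by `u` multiplies it by `u`. -/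
lemma powerSeparated_handle_toPerm {R : Type*} [CommRing R] [IsDomain R] {u : Rˣ}
    (h : ∀ i n m : ℤ, (u ^ i : Rˣ) * (n : R) = m → i = 0 ∨ n = 0) :
    PowerSeparated (handle (MulAction.toPerm u) (AddAction.toPerm (1 : R)))
      (MulAction.toPerm u : Equiv.Perm R) := by
  intro i n m heq
  have hw : (1 : R) - ↑u⁻¹ * 1 ≠ 0 := fun hw => by
    obtain rfl : u = 1 := by
      rwa [mul_one, sub_eq_zero, eq_comm, Units.val_eq_one, inv_eq_one] at hw
    simpa using h 1 1 1
  refine h i n m (mul_right_cancel₀ hw ?_)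
  rw [handle_toPerm, toPerm_zpow, toPerm_zpow] at heq
  have hpow (i : ℤ) (x : R) : ((MulAction.toPerm u : Equiv.Perm R) ^ i) x = (u ^ i : Rˣ) * x :=
    congr($((map_zpow (MulAction.toPermHom Rˣ R) u i).symm) x)
  have h0 := congr($heq 0)
  rw [Equiv.Perm.mul_apply, Equiv.Perm.mul_apply, hpow, hpow, mul_zero] at h0
  simpa [zsmul_eq_mul, mul_assoc] using h0

/-- The generators of the free group on `n` handles, continued by `1`. -/
def freeGen (n : ℕ) (r : Fin 2) (j : ℕ) : FreeGroup (Fin n × Fin 2) :=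
  if h : j < n then FreeGroup.of (⟨j, h⟩, r) else 1

/-- The homomorphism from the free group on `n` handles with values `C r j` on the generators. -/
def freeLift (n : ℕ) (C : Fin 2 → ℕ → G) : FreeGroup (Fin n × Fin 2) →* G :=
  FreeGroup.lift fun p => C p.2 p.1

lemma freeLift_freeGen {n : ℕ} (C : Fin 2 → ℕ → G) (r : Fin 2) {j : ℕ} (hj : j < n) :
    freeLift n C (freeGen n r j) = C r j := by
  rw [freeLift, freeGen, dif_pos hj, FreeGroup.lift_apply_of]

lemma freeLift_handleProd (n : ℕ) (C : Fin 2 → ℕ → G) :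
    freeLift n C (handleProd (freeGen n) n) = handleProd C n := by
  rw [map_handleProd]
  exact handleProd_congr fun r j hj => freeLift_freeGen C r hj

lemma freeGroup_hom_ext {n : ℕ} {f f' : FreeGroup (Fin n × Fin 2) →* G}
    (h : ∀ r, ∀ j < n, f (freeGen n r j) = f' (freeGen n r j)) : f = f' := by
  ext ⟨j, r⟩
  simpa only [freeGen, j.2, dite_true] using h r j j.2

lemma handleProd_succ_of_eq_one {C : Fin 2 → ℕ → G} (hC : ∀ r j, C r (j + 1) = 1) (n : ℕ) :
    handleProd C (n + 1) = handle (C 0 0) (C 1 0) := by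
  induction n with
  | zero => rw [handleProd, handleProd, mul_one]
  | succ n ih => rw [handleProd, ih, hC, hC, handle, inv_one, mul_one, mul_one, mul_one, one_mul]

open LaurentPolynomial in
lemma powerSeparated_handleProd_freeGen (n : ℕ) :
    PowerSeparated (handleProd (freeGen (n + 1)) (n + 1)) (freeGen (n + 1) 0 0) := by
  let u : ℤ[T;T⁻¹]ˣ := MonoidHom.toHomUnits (AddMonoidAlgebra.of ℤ ℤ) (.ofAdd 1)
  have hu (i : ℤ) : ((u ^ i : ℤ[T;T⁻¹]ˣ) : ℤ[T;T⁻¹]) = T i := by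
    rw [← map_zpow, ← ofAdd_zsmul, smul_eq_mul, mul_one]
    rfl
  let D : Fin 2 → Equiv.Perm ℤ[T;T⁻¹] := ![MulAction.toPerm u, AddAction.toPerm (1 : ℤ[T;T⁻¹])]
  let C : Fin 2 → ℕ → Equiv.Perm ℤ[T;T⁻¹] := fun r j => if j = 0 then D r else 1
  refine .of_map (freeLift (n + 1) C) ?_
  rw [freeLift_handleProd, freeLift_freeGen C 0 n.succ_pos,
    handleProd_succ_of_eq_one fun _ _ => if_neg (Nat.succ_ne_zero _)]
  refine powerSeparated_handle_toPerm fun i n m h => ?_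
  refine or_iff_not_imp_left.2 fun hi => ?_
  have hsmul : n • (T i : ℤ[T;T⁻¹]) = m • T 0 := by
    rw [zsmul_eq_mul, zsmul_eq_mul, T_zero, mul_one, ← h, hu, mul_comm]
  have hcoeff := congrArg (fun f => f.coeff i) hsmul
  simp only [AddMonoidAlgebra.coeff_smul, Finsupp.smul_apply, T_apply,
    if_neg (Ne.symm hi)] at hcoeff
  simpa using hcoeff

/-- The family `C` generates `Γ` subject to the relation of the surface group of genus `g` only.
The universal property is only required for homomorphisms into groups of permutations. -/
structure IsSurfacePresentation {Γ : Type*} [Group Γ] (g : ℕ) (C : Fin 2 → ℕ → Γ) : Prop where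
  handleProd_eq_one : handleProd C g = 1
  closure_eq_top : Subgroup.closure (⋃ r, C r '' Set.Iio g) = ⊤
  exists_hom : ∀ (Y : Type) (D : Fin 2 → ℕ → Equiv.Perm Y), handleProd D g = 1 →
    ∃ θ : Γ →* Equiv.Perm Y, ∀ r, ∀ j < g, θ (C r j) = D r j

variable {Γ : Type*} [Group Γ]

lemma IsSurfacePresentation.isAmalgam {n : ℕ} {C : Fin 2 → ℕ → Γ}
    (hC : IsSurfacePresentation (n + 1) C) :
    IsAmalgam (freeLift 1 C) (freeLift n fun r j => C r (j + 1)) (handleProd (freeGen 1) 1)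
      (handleProd (freeGen n) n)⁻¹ where
  map_eq_map := by
    rw [map_inv, freeLift_handleProd, freeLift_handleProd, handleProd, handleProd, mul_one]
    exact eq_inv_of_mul_eq_one_right (handleProd_succ' C n ▸ hC.handleProd_eq_one)
  sup_range_eq_top := by
    rw [eq_top_iff, ← hC.closure_eq_top, Subgroup.closure_le]
    refine Set.iUnion_subset fun r => ?_
    rintro _ ⟨_ | j, hj, rfl⟩
    · exact Subgroup.mem_sup_left ⟨_, freeLift_freeGen C r one_pos⟩
    · exact Subgroup.mem_sup_right ⟨_, freeLift_freeGen _ r (Nat.lt_of_succ_lt_succ hj)⟩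
  exists_lift Y ρ σ hρσ := by
    let D : Fin 2 → ℕ → Equiv.Perm Y := fun r j =>
      j.casesOn (ρ (freeGen 1 r 0)) fun j => σ (freeGen n r j)
    have hD : handleProd D (n + 1) = 1 := by
      rw [map_inv, map_handleProd, map_handleProd] at hρσ
      rw [handleProd_succ', ← mul_eq_one_iff_eq_inv'.2 hρσ, handleProd, handleProd, mul_one]
      rfl
    obtain ⟨θ, hθ⟩ := hC.exists_hom Y D hD
    refine ⟨θ, freeGroup_hom_ext fun r j hj => ?_, freeGroup_hom_ext fun r j hj => ?_⟩
    · obtain rfl := Nat.lt_one_iff.1 hj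
      rw [MonoidHom.comp_apply, freeLift_freeGen C r hj, hθ r 0 n.succ_pos]
      rfl
    · rw [MonoidHom.comp_apply, freeLift_freeGen _ r hj, hθ r _ (Nat.succ_lt_succ hj)]

theorem IsSurfacePresentation.hasFaithfulHighlyTransitiveAction {g : ℕ} (hg : 2 ≤ g)
    {C : Fin 2 → ℕ → Γ} (hC : IsSurfacePresentation g C) :
    HasFaithfulHighlyTransitiveAction Γ := by
  obtain ⟨n, rfl⟩ := Nat.exists_eq_add_of_le' hg
  have hsep := powerSeparated_handleProd_freeGen n
  refine hC.isAmalgam.hasFaithfulHighlyTransitiveAction (fun k => ?_)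
    (powerSeparated_handleProd_freeGen 0) (b := freeGen (n + 1) 0 0) ?_
  · rw [(powerSeparated_handleProd_freeGen 0).zpow_eq_one_iff, inv_zpow, inv_eq_one,
      hsep.zpow_eq_one_iff]
  · rw [Subgroup.zpowers_inv]
    exact hsep.notMem_zpowers

end SurfaceRelation

/-! ### Generators of the fundamental group of a quotient -/

section QuotientSpace

open Topology unitInterval Path

lemma mk_subpath_trans {X : Type*} [TopologicalSpace X] {x y : X} (q : Path x y) (r s t : I) :
    (Homotopic.Quotient.mk (q.subpath r s)).trans (.mk (q.subpath s t)) = .mk (q.subpath r t) := by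
  rw [← Homotopic.Quotient.mk_trans, Homotopic.Quotient.eq]
  exact ⟨.subpathTransSubpath q r s t⟩

theorem pathClass_induction {X : Type*} [TopologicalSpace X] {ι : Type*} {U : ι → Set X}
    (hopen : ∀ i, IsOpen (U i)) (hcover : ⋃ i, U i = Set.univ)
    {M : ∀ {x y : X}, Homotopic.Quotient x y → Prop}
    (mk : ∀ (i : ι) {x y : X} (q : Path x y), (∀ t, q t ∈ U i) → M (.mk q))
    (trans : ∀ {x y z : X} (γ : Homotopic.Quotient x y) (γ' : Homotopic.Quotient y z),
      M γ → M γ' → M (γ.trans γ')) {x y : X} (γ : Homotopic.Quotient x y) : M γ := by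
  induction γ using Homotopic.Quotient.ind with | mk q =>
  obtain ⟨t, ht0, hmono, ⟨N, hN⟩, ht⟩ := exists_monotone_Icc_subset_open_cover_unitInterval
    (c := fun i => q ⁻¹' U i) (fun i => (hopen i).preimage q.continuous)
    (by rw [← Set.preimage_iUnion, hcover, Set.preimage_univ])
  have hpiece (n : ℕ) : M (.mk (q.subpath (t n) (t (n + 1)))) := by
    obtain ⟨i, hi⟩ := ht n
    refine mk i _ fun s => ?_
    obtain ⟨r, hr, hrs⟩ := q.range_subpath_of_le _ _ (hmono n.le_succ) ▸ Set.mem_range_self s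
    exact hrs ▸ hi hr
  have hinit (n : ℕ) : M (.mk (q.subpath (t 0) (t (n + 1)))) := by
    induction n with
    | zero => exact hpiece 0
    | succ n ih =>
      exact mk_subpath_trans q (t 0) (t (n + 1)) (t (n + 2)) ▸ trans _ _ ih (hpiece _)
  have hq := hinit N
  rw [ht0, hN (N + 1) N.le_succ] at hq
  obtain ⟨f, rfl, rfl⟩ := q
  simpa using hq

variable {D Q : Type*} [TopologicalSpace D] [TopologicalSpace Q]

section PathConnected

variable [PathConnectedSpace D]

/-- The class of the image of a path from `z₀` to `z`. -/
noncomputable def spoke (p : C(D, Q)) (z₀ z : D) {x : Q} (h : p z = x) :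
    Homotopic.Quotient (p z₀) x :=
  ((Homotopic.Quotient.mk (PathConnectedSpace.somePath z₀ z)).map p).cast rfl h.symm

/-- The loop at `p z₀` that reaches the start of `γ` on a spoke, follows `γ` and comes back on a
spoke. -/
noncomputable def spokeLoop (p : C(D, Q)) (z₀ : D) {x y : Q} (γ : Homotopic.Quotient x y)
    {z w : D} (hz : p z = x) (hw : p w = y) : FundamentalGroup Q (p z₀) :=
  .fromPath ((spoke p z₀ z hz).trans (γ.trans (spoke p z₀ w hw).symm))

/-- The loop at `p z₀` that reaches `p z = p w` on the spoke of `z` and comes back on the spoke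
of `w`. -/
noncomputable def jump (p : C(D, Q)) (z₀ z w : D) (h : p z = p w) : FundamentalGroup Q (p z₀) :=
  spokeLoop p z₀ (.refl (p z)) rfl h.symm

variable (p : C(D, Q)) (z₀ : D)

lemma spokeLoop_mul {x y y' : Q} (γ : Homotopic.Quotient x y) (γ' : Homotopic.Quotient y y')
    {z w v : D} (hz : p z = x) (hw : p w = y) (hv : p v = y') :
    spokeLoop p z₀ γ' hw hv * spokeLoop p z₀ γ hz hw = spokeLoop p z₀ (γ.trans γ') hz hv := by
  rw [FundamentalGroup.mul_def]
  simp only [spokeLoop, Homotopic.Quotient.trans_assoc]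
  rw [← Homotopic.Quotient.trans_assoc (spoke p z₀ w hw).symm, Homotopic.Quotient.symm_trans,
    Homotopic.Quotient.refl_trans]

lemma spokeLoop_refl {z w : D} {x : Q} (hz : p z = x) (hw : p w = x) :
    spokeLoop p z₀ (.refl x) hz hw = jump p z₀ z w (hz.trans hw.symm) := by
  subst hz
  rfl

lemma jump_mul {z w v : D} (h : p z = p w) (h' : p w = p v) :
    jump p z₀ w v h' * jump p z₀ z w h = jump p z₀ z v (h.trans h') := by
  rw [← spokeLoop_refl p z₀ h.symm (h.trans h').symm, jump, jump, spokeLoop_mul,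
    Homotopic.Quotient.refl_trans]

end PathConnected

section SimplyConnected

variable [SimplyConnectedSpace D] (p : C(D, Q)) (z₀ : D)

lemma spoke_trans {z w : D} (f : Path z w) {x y : Q} (hx : p z = x) (hy : p w = y) (q : Path x y)
    (hq : ∀ t, q t = p (f t)) : (spoke p z₀ z hx).trans (.mk q) = spoke p z₀ w hy := by
  subst hx hy
  obtain rfl : q = f.map p.continuous := Path.ext (funext hq)
  have hf : Homotopic.Quotient.mk ((PathConnectedSpace.somePath z₀ z).trans f) =
      .mk (PathConnectedSpace.somePath z₀ w) := Subsingleton.elim _ _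
  simpa only [spoke, Homotopic.Quotient.cast_rfl_rfl, ← Homotopic.Quotient.mk_map,
    ← Homotopic.Quotient.mk_trans, Path.map_trans] using congrArg (Homotopic.Quotient.map · p) hf

lemma spokeLoop_self (γ : FundamentalGroup Q (p z₀)) : spokeLoop p z₀ γ rfl rfl = γ := by
  have hspoke : spoke p z₀ z₀ rfl = .refl (p z₀) :=
    congrArg (Homotopic.Quotient.map · p) (Subsingleton.elim (Homotopic.Quotient.mk _) (.refl z₀))
  have hsymm : (Homotopic.Quotient.refl (p z₀)).symm = .refl (p z₀) :=
    congrArg Homotopic.Quotient.mk Path.refl_symm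
  rw [spokeLoop, hspoke, hsymm, Homotopic.Quotient.refl_trans]
  exact Homotopic.Quotient.trans_refl γ

lemma spokeLoop_eq_one {z w : D} (f : Path z w) {x y : Q} (hx : p z = x) (hy : p w = y)
    (q : Path x y) (hq : ∀ t, q t = p (f t)) : spokeLoop p z₀ (.mk q) hx hy = 1 := by
  rw [spokeLoop, ← Homotopic.Quotient.trans_assoc, spoke_trans p z₀ f hx hy q hq]
  exact Homotopic.Quotient.trans_symm _

lemma jump_self (z : D) : jump p z₀ z z rfl = 1 :=
  spokeLoop_eq_one p z₀ (Path.refl z) rfl rfl (Path.refl _) fun _ => rfl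

lemma jump_inv {z w : D} (h : p z = p w) : (jump p z₀ z w h)⁻¹ = jump p z₀ w z h.symm :=
  inv_eq_of_mul_eq_one_right (by rw [jump_mul, jump_self])

lemma jump_congr_of_paths {z w z' w' : D} (f : Path z w) (f' : Path z' w')
    (h : ∀ t, p (f t) = p (f' t)) (hz : p z = p z') (hw : p w = p w') :
    jump p z₀ z z' hz = jump p z₀ w w' hw := by
  let q : Path (p z) (p w) := f.map p.continuous
  calc jump p z₀ z z' hz
    _ = spokeLoop p z₀ (.mk q) hz.symm hw.symm * spokeLoop p z₀ (.refl (p z)) rfl hz.symm := by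
      rw [spokeLoop_eq_one p z₀ f' _ _ q h, one_mul, jump]
    _ = spokeLoop p z₀ (.refl (p w)) rfl hw.symm * spokeLoop p z₀ (.mk q) rfl rfl := by
      rw [spokeLoop_mul, spokeLoop_mul, Homotopic.Quotient.refl_trans,
        Homotopic.Quotient.trans_refl]
    _ = jump p z₀ w w' hw := by
      rw [spokeLoop_eq_one p z₀ f _ _ q fun _ => rfl, mul_one, jump]

end SimplyConnected

lemma eventually_eq_of_isQuotientMap {α : Type*} {p : D → Q} (hp : IsQuotientMap p) {U : Set Q}
    (hU : IsOpen U) {f : Q → α} (hf : ∀ z, p z ∈ U → ∀ᶠ w in 𝓝 z, f (p w) = f (p z)) {x : Q}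
    (hx : x ∈ U) : ∀ᶠ y in 𝓝 x, f y = f x := by
  have hopen : IsOpen {y | y ∈ U ∧ f y = f x} := by
    rw [← hp.isOpen_preimage, isOpen_iff_mem_nhds]
    rintro z ⟨hz, hzx⟩
    filter_upwards [hf z hz, (hU.preimage hp.continuous).mem_nhds hz] with w hw hwU
    exact ⟨hwU, hw.trans hzx⟩
  filter_upwards [hopen.mem_nhds ⟨hx, rfl⟩] with y hy using hy.2

/-- A deformation of the open set `U ⊆ Q` along paths that lift to `D`, whose final map is locally
constant. -/
structure IsContraction (p : C(D, Q)) (U : Set Q) (k : D → C(I, D)) : Prop where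
  isOpen : IsOpen U
  continuousOn : ContinuousOn k (p ⁻¹' U)
  start : ∀ z, p z ∈ U → k z 0 = z
  compat : ∀ z w, p z = p w → p z ∈ U → ∀ t, p (k z t) = p (k w t)
  eventually_eq : ∀ z, p z ∈ U → ∀ᶠ w in 𝓝 z, p (k w 1) = p (k z 1)

namespace IsContraction

variable {p : C(D, Q)} {U : Set Q} {k : D → C(I, D)}

lemma exists_descent (hp : IsQuotientMap p) (hk : IsContraction p U k) :
    ∃ m : Q → C(I, Q), ContinuousOn m U ∧ ∀ z, p z ∈ U → m (p z) = p.comp (k z) := by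
  let m : Q → C(I, Q) := fun x => p.comp (k (Function.surjInv hp.surjective x))
  have hm (z : D) (hz : p z ∈ U) : m (p z) = p.comp (k z) := by
    have hinv := Function.surjInv_eq hp.surjective (p z)
    exact ContinuousMap.ext fun t => hk.compat _ _ hinv (by rwa [hinv]) t
  refine ⟨m, (hp.continuousOn_isOpen_iff hk.isOpen).2 ?_, hm⟩
  exact ((ContinuousMap.continuous_postcomp p).comp_continuousOn hk.continuousOn).congr hm

lemma exists_homotopy_const (hp : IsQuotientMap p) (hk : IsContraction p U k) (f : C(I, Q))
    (hf : ∀ t, f t ∈ U) : ∃ (y : Q) (F : f.Homotopy (.const I y)),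
      ∀ s v, p v = f s → ∀ t, F (t, s) = p (k v t) := by
  obtain ⟨m, hmU, hm⟩ := hk.exists_descent hp
  have hmf (s : I) (v : D) (hv : p v = f s) : m (f s) = p.comp (k v) := by
    rw [← hv, hm v (hv ▸ hf s)]
  have hlocal : IsLocallyConstant fun s => m (f s) 1 := by
    rw [IsLocallyConstant.iff_eventually_eq]
    intro s
    refine f.continuous.continuousAt.eventually (eventually_eq_of_isQuotientMap hp hk.isOpen
      (f := fun x => m x 1) (fun v hv => ?_) (hf s))
    filter_upwards [hk.eventually_eq v hv, (hk.isOpen.preimage p.continuous).mem_nhds hv]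
      with u hu huU
    rw [hm u huU, hm v hv, p.comp_apply, p.comp_apply, hu]
  refine ⟨m (f 0) 1,
    { toFun := fun s => m (f s.2) s.1
      continuous_toFun := (ContinuousMap.continuous_uncurry_of_continuous
        ⟨_, hmU.comp_continuous f.continuous hf⟩).comp continuous_swap
      map_zero_left := fun s => ?_
      map_one_left := fun s => hlocal.apply_eq_of_preconnectedSpace s 0 },
    fun s v hv t => congr($(hmf s v hv) t)⟩
  obtain ⟨v, hv⟩ := hp.surjective (f s)
  rw [hmf s v hv, p.comp_apply, hk.start v (hv ▸ hf s), hv]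

lemma exists_eq_jump [SimplyConnectedSpace D] (hp : IsQuotientMap p) (hk : IsContraction p U k)
    (z₀ : D) {x y : Q} (q : Path x y) (hq : ∀ t, q t ∈ U) {z w : D} (hz : p z = x) (hw : p w = y) :
    ∃ z' w', ∃ h : p z' = p w', spokeLoop p z₀ (.mk q) hz hw = jump p z₀ z' w' h := by
  obtain ⟨f, rfl, rfl⟩ := q
  obtain ⟨y, F, hF⟩ := hk.exists_homotopy_const hp f hq
  let f' : Path (f 0) (f 1) := ⟨f, rfl, rfl⟩
  let l (s : I) : Path (f s) y := F.evalAt s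
  let kz : Path z (k z 1) := ⟨k z, hk.start z (hz ▸ hq 0), rfl⟩
  let kw : Path w (k w 1) := ⟨k w, hk.start w (hw ▸ hq 1), rfl⟩
  have hz1 : p (k z 1) = y := by rw [← hF 0 z hz, F.apply_one, ContinuousMap.const_apply]
  have hw1 : p (k w 1) = y := by rw [← hF 1 w hw, F.apply_one, ContinuousMap.const_apply]
  have hsquare : (Homotopic.Quotient.mk ⟨f, rfl, rfl⟩).trans (.mk (l 1)) =
      (Homotopic.Quotient.mk (l 0)).trans (.refl y) :=
    Homotopic.Quotient.eq.2 (Path.Homotopic.map_trans_evalAt F .id)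
  refine ⟨k z 1, k w 1, hz1.trans hw1.symm, ?_⟩
  calc spokeLoop p z₀ (.mk f') hz hw
    _ = spokeLoop p z₀ (.mk (l 1)) hw hw1 * spokeLoop p z₀ (.mk f') hz hw := by
      rw [spokeLoop_eq_one p z₀ kw hw hw1 _ fun t => hF 1 w hw t, one_mul]
    _ = spokeLoop p z₀ (.refl y) hz1 hw1 * spokeLoop p z₀ (.mk (l 0)) hz hz1 := by
      rw [spokeLoop_mul, spokeLoop_mul, hsquare]
    _ = jump p z₀ (k z 1) (k w 1) _ := by
      rw [spokeLoop_eq_one p z₀ kz hz hz1 _ fun t => hF 0 z hz t, mul_one, spokeLoop_refl]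

end IsContraction

theorem eq_top_of_jump_mem [SimplyConnectedSpace D] {p : C(D, Q)} (hp : IsQuotientMap p) (z₀ : D)
    {ι : Type*} {U : ι → Set Q} {k : ι → D → C(I, D)} (hk : ∀ i, IsContraction p (U i) (k i))
    (hU : ⋃ i, U i = Set.univ) (P : Subgroup (FundamentalGroup Q (p z₀)))
    (hP : ∀ z w h, jump p z₀ z w h ∈ P) : P = ⊤ := by
  refine P.eq_top_iff'.2 fun γ => spokeLoop_self p z₀ γ ▸ ?_
  suffices h : ∀ {x y : Q} (γ : Homotopic.Quotient x y) {z w : D} (hz : p z = x) (hw : p w = y),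
      spokeLoop p z₀ γ hz hw ∈ P from h γ rfl rfl
  intro x y γ
  refine pathClass_induction (M := fun {x y} γ => ∀ {z w : D} (hz : p z = x) (hw : p w = y),
    spokeLoop p z₀ γ hz hw ∈ P) (fun i => (hk i).isOpen) hU ?_ ?_ γ
  · intro i x y q hq z w hz hw
    obtain ⟨z', w', h, hjump⟩ := (hk i).exists_eq_jump hp z₀ q hq hz hw
    exact hjump ▸ hP z' w' h
  · intro x y y' γ γ' hγ hγ' z v hz hv
    obtain ⟨w, hw⟩ := hp.surjective y
    exact spokeLoop_mul p z₀ γ γ' hz hw hv ▸ P.mul_mem (hγ' hw hv) (hγ hz hw)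

end QuotientSpace

/-! ### Coverings of a quotient -/

section Covering

open Topology Bundle

variable {D Q ι : Type*} [TopologicalSpace D] [TopologicalSpace Q] {p : C(D, Q)} {U : ι → Set Q}

/-- An open cover of `Q` with locally constant labels `ℓ i` over its members such that the quotients
of two labels descend to `Q`, where they serve as the transition functions of a covering. The labels
themselves need not descend. -/
structure IsTransitionLabelling {G : Type*} [Group G] (p : C(D, Q)) (U : ι → Set Q)
    (ℓ : ι → D → G) : Prop where
  isOpen : ∀ i, IsOpen (U i)
  iUnion_eq : ⋃ i, U i = Set.univ
  eventually_eq : ∀ i z, p z ∈ U i → ∀ᶠ w in 𝓝 z, ℓ i w = ℓ i z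
  transition_eq : ∀ i k z w, p z = p w → p z ∈ U i → p z ∈ U k →
    (ℓ k z)⁻¹ * ℓ i z = (ℓ k w)⁻¹ * ℓ i w

/-- The transition function from the `i`-th to the `k`-th chart. -/
noncomputable def transition {G : Type*} [Group G] (hp : IsQuotientMap p) (ℓ : ι → D → G)
    (i k : ι) (x : Q) : G :=
  (ℓ k (Function.surjInv hp.surjective x))⁻¹ * ℓ i (Function.surjInv hp.surjective x)

namespace IsTransitionLabelling

section Transition

variable {G : Type*} [Group G] {ℓ : ι → D → G}

lemma exists_mem (hℓ : IsTransitionLabelling p U ℓ) (x : Q) : ∃ i, x ∈ U i :=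
  Set.mem_iUnion.1 (hℓ.iUnion_eq ▸ Set.mem_univ x)

lemma transition_apply (hp : IsQuotientMap p) (hℓ : IsTransitionLabelling p U ℓ) {i k : ι} {z : D}
    (hi : p z ∈ U i) (hk : p z ∈ U k) : transition hp ℓ i k (p z) = (ℓ k z)⁻¹ * ℓ i z :=
  (hℓ.transition_eq i k z _ (Function.surjInv_eq hp.surjective (p z)).symm hi hk).symm

lemma eventually_transition_eq (hp : IsQuotientMap p) (hℓ : IsTransitionLabelling p U ℓ) {i k : ι}
    {x : Q} (hx : x ∈ U i ∩ U k) :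
    ∀ᶠ y in 𝓝 x, transition hp ℓ i k y = transition hp ℓ i k x := by
  have hopen : IsOpen (U i ∩ U k) := (hℓ.isOpen i).inter (hℓ.isOpen k)
  refine eventually_eq_of_isQuotientMap hp hopen (fun z hz => ?_) hx
  filter_upwards [hℓ.eventually_eq i z hz.1, hℓ.eventually_eq k z hz.2,
    (hopen.preimage p.continuous).mem_nhds hz] with w hwi hwk hw
  rw [hℓ.transition_apply hp hw.1 hw.2, hℓ.transition_apply hp hz.1 hz.2, hwi, hwk]

end Transition

variable {Y : Type*} [TopologicalSpace Y] [DiscreteTopology Y] {ℓ : ι → D → Equiv.Perm Y}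
  (hp : IsQuotientMap p) (hℓ : IsTransitionLabelling p U ℓ)

/-- The covering with fibre `Y` whose transition functions are the quotients of the labels. -/
noncomputable def coveringCore : FiberBundleCore ι Q Y where
  baseSet := U
  isOpen_baseSet := hℓ.isOpen
  indexAt x := (hℓ.exists_mem x).choose
  mem_baseSet_at x := (hℓ.exists_mem x).choose_spec
  coordChange i k x y := transition hp ℓ i k x y
  coordChange_self i x _ y := by simp [transition]
  continuousOn_coordChange i k := by
    rintro ⟨x, y⟩ ⟨hx, -⟩
    have hlocal : ∀ᶠ q : Q × Y in 𝓝 (x, y),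
        transition hp ℓ i k q.1 q.2 = transition hp ℓ i k x y := by
      have hy : ∀ᶠ y' in 𝓝 y, y' = y := by rw [nhds_discrete]; rfl
      rw [nhds_prod_eq]
      filter_upwards [(hℓ.eventually_transition_eq hp hx).prod_mk hy] with q hq
      rw [hq.1, hq.2]
    exact (continuousAt_const.congr (hlocal.mono fun _ => Eq.symm)).continuousWithinAt
  coordChange_comp i j k x _ y := by simp [transition]

/-- The lift of `D` to the covering that has coordinate `y` where the label is trivial. -/
noncomputable def lift (y : Y) (z : D) : TotalSpace Y (hℓ.coveringCore hp).Fiber :=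
  ⟨p z, (ℓ ((hℓ.coveringCore hp).indexAt (p z)) z)⁻¹ y⟩

lemma continuous_lift (y : Y) : Continuous (hℓ.lift hp y) := by
  refine continuous_iff_continuousAt.2 fun z =>
    (FiberBundle.continuousAt_totalSpace _ _).2 ⟨p.continuous.continuousAt, ?_⟩
  let index := (hℓ.coveringCore hp).indexAt
  have hz : p z ∈ U (index (p z)) := (hℓ.coveringCore hp).mem_baseSet_at (p z)
  refine (continuousAt_const (y := (ℓ (index (p z)) z)⁻¹ y)).congr ?_
  filter_upwards [((hℓ.isOpen _).preimage p.continuous).mem_nhds hz, hℓ.eventually_eq _ z hz]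
    with w hw hwz
  change _ = transition hp ℓ (index (p w)) (index (p z)) (p w) ((ℓ (index (p w)) w)⁻¹ y)
  rw [hℓ.transition_apply hp ((hℓ.coveringCore hp).mem_baseSet_at (p w)) hw, hwz]
  simp [index]

lemma lift_eq_lift {z w : D} (h : p z = p w) {c : Equiv.Perm Y}
    (hc : ∀ i, p z ∈ U i → ℓ i w = c * ℓ i z) (y : Y) : hℓ.lift hp y z = hℓ.lift hp (c y) w := by
  rw [lift, lift, ← h, hc _ ((hℓ.coveringCore hp).mem_baseSet_at (p z))]
  simp

lemma isCoveringMap : IsCoveringMap (π Y (hℓ.coveringCore hp).Fiber) := FiberBundle.isCoveringMap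

/-- The identification of `Y` with the fibre over `p z₀` by the lifts of `D`. -/
noncomputable def fibreEquiv (z₀ : D) : Y ≃ (π Y (hℓ.coveringCore hp).Fiber) ⁻¹' {p z₀} where
  toFun y := ⟨hℓ.lift hp y z₀, rfl⟩
  invFun v := ℓ ((hℓ.coveringCore hp).indexAt (p z₀)) z₀ v.1.2
  left_inv y := Equiv.apply_symm_apply _ y
  right_inv := by
    rintro ⟨⟨x, v⟩, hx⟩
    obtain rfl : x = _ := hx
    exact Subtype.ext (congrArg (TotalSpace.mk _) (Equiv.symm_apply_apply _ v))

variable [PathConnectedSpace D]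

lemma monodromy_spoke (y : Y) (z₀ z : D) {x : Q} (h : p z = x) :
    (hℓ.isCoveringMap hp).monodromy (spoke p z₀ z h) ⟨hℓ.lift hp y z₀, rfl⟩ =
      ⟨hℓ.lift hp y z, h⟩ := by
  subst h
  let f : C(D, TotalSpace Y (hℓ.coveringCore hp).Fiber) := ⟨hℓ.lift hp y, hℓ.continuous_lift hp y⟩
  refine (hℓ.isCoveringMap hp).monodromy_eq_of_map_eq
    ((Path.Homotopic.Quotient.mk (PathConnectedSpace.somePath z₀ z)).map f) ?_
  rw [← Path.Homotopic.Quotient.map_comp]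
  rfl

lemma monodromy_jump {y y' : Y} (z₀ : D) {z w : D} (h : p z = p w)
    (hzw : hℓ.lift hp y z = hℓ.lift hp y' w) :
    (hℓ.isCoveringMap hp).monodromy (jump p z₀ z w h) ⟨hℓ.lift hp y z₀, rfl⟩ =
      ⟨hℓ.lift hp y' z₀, rfl⟩ := by
  have hback := (hℓ.isCoveringMap hp).monodromy_trans_apply (spoke p z₀ w h.symm)
    (spoke p z₀ w h.symm).symm ⟨hℓ.lift hp y' z₀, rfl⟩
  rw [Path.Homotopic.Quotient.trans_symm, IsCoveringMap.monodromy_refl, monodromy_spoke] at hback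
  have hjump : jump p z₀ z w h = (spoke p z₀ z rfl).trans (spoke p z₀ w h.symm).symm := by
    rw [jump, spokeLoop, Path.Homotopic.Quotient.refl_trans]
  rw [hjump, IsCoveringMap.monodromy_trans_apply, monodromy_spoke]
  simp only [hzw]
  exact hback.symm

/-- The permutation representation of the fundamental group on the fibre. -/
noncomputable def monodromyHom (z₀ : D) : FundamentalGroup Q (p z₀) →* Equiv.Perm Y :=
  ((hℓ.fibreEquiv hp z₀).symm.permCongrHom : _ →* Equiv.Perm Y).comp
    ((hℓ.isCoveringMap hp).monodromyPerm (p z₀))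

lemma monodromyHom_jump (z₀ : D) {z w : D} (h : p z = p w) {c : Equiv.Perm Y}
    (hc : ∀ i, p z ∈ U i → ℓ i w = c * ℓ i z) :
    hℓ.monodromyHom hp z₀ (jump p z₀ z w h) = c := by
  ext1 y
  exact (Equiv.symm_apply_eq (hℓ.fibreEquiv hp z₀)).2
    (hℓ.monodromy_jump hp z₀ h (hℓ.lift_eq_lift hp h hc y))

end IsTransitionLabelling

theorem exists_hom_jump_eq {Y : Type*} {ℓ : ι → D → Equiv.Perm Y} [PathConnectedSpace D]
    (hp : IsQuotientMap p) (hℓ : IsTransitionLabelling p U ℓ) (z₀ : D) :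
    ∃ θ : FundamentalGroup Q (p z₀) →* Equiv.Perm Y, ∀ (z w : D) (h : p z = p w)
      (c : Equiv.Perm Y), (∀ i, p z ∈ U i → ℓ i w = c * ℓ i z) → θ (jump p z₀ z w h) = c := by
  let _ : TopologicalSpace Y := ⊥
  have : DiscreteTopology Y := ⟨rfl⟩
  exact ⟨hℓ.monodromyHom hp z₀, fun z w h c => hℓ.monodromyHom_jump hp z₀ h⟩

end Covering

/-! ### Polar coordinates on the polygon -/

section Cells

open Topology

/-- The complement of the grid `ℤ - e / 2`. -/
def offGrid (e : ℕ) : Set ℝ := {s | ∀ m : ℤ, s + e / 2 ≠ m}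

/-- The index of the interval cut out by the grid `ℤ - e / 2` that contains `s`. -/
noncomputable def cell (e : ℕ) (s : ℝ) : ℤ := ⌊s + e / 2⌋

/-- The midpoint of the interval cut out by the grid `ℤ - e / 2` that contains `s`. -/
noncomputable def snap (e : ℕ) (s : ℝ) : ℝ := cell e s + 1 / 2 - e / 2

lemma add_intCast_mem_offGrid {e : ℕ} {s : ℝ} (m : ℤ) : s + m ∈ offGrid e ↔ s ∈ offGrid e := by
  refine ⟨fun h n hn => h (n + m) ?_, fun h n hn => h (n - m) ?_⟩ <;> push_cast <;> linarith

lemma intCast_sub_mem_offGrid {e : ℕ} {s : ℝ} (n : ℤ) : n - s ∈ offGrid e ↔ s ∈ offGrid e := by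
  refine ⟨fun h m hm => h (n + e - m) ?_, fun h m hm => h (n + e - m) ?_⟩ <;>
    push_cast <;> linarith

lemma cell_add_intCast (e : ℕ) (s : ℝ) (m : ℤ) : cell e (s + m) = cell e s + m := by
  rw [cell, cell, add_right_comm, Int.floor_add_intCast]

lemma cell_le (e : ℕ) (s : ℝ) : cell e s ≤ s + e / 2 := Int.floor_le _

lemma lt_cell_add_one (e : ℕ) (s : ℝ) : s + e / 2 < cell e s + 1 := Int.lt_floor_add_one _

lemma cell_lt {e : ℕ} {s : ℝ} (hs : s ∈ offGrid e) : cell e s < s + e / 2 :=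
  lt_of_le_of_ne (cell_le e s) (hs _).symm

lemma cell_intCast_sub {e : ℕ} {s : ℝ} (hs : s ∈ offGrid e) (n : ℤ) :
    cell e (n - s) = n + e - 1 - cell e s := by
  have h₁ := cell_lt hs
  have h₂ := lt_cell_add_one e s
  refine Int.floor_eq_iff.2 ⟨?_, ?_⟩ <;> push_cast <;> linarith

lemma cell_mem_Icc {e : ℕ} (he : e < 2) {s : ℝ} (hs : s ∈ offGrid e) {k : ℤ}
    (hk : s ∈ Set.Icc (k : ℝ) (k + 1)) : cell e s ∈ Set.Icc k (k + e) := by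
  have : (e : ℝ) ≤ 1 := by exact_mod_cast Nat.lt_succ_iff.1 he
  have : (0 : ℝ) ≤ e := e.cast_nonneg
  have hlt : (cell e s : ℝ) < k + e + 1 := by linarith [cell_lt hs, hk.2]
  refine ⟨Int.le_floor.2 (by linarith [hk.1]), Int.lt_add_one_iff.1 ?_⟩
  exact_mod_cast hlt

lemma eventually_cell_eq {e : ℕ} {s : ℝ} (hs : s ∈ offGrid e) :
    ∀ᶠ u in 𝓝 s, u ∈ offGrid e ∧ cell e u = cell e s := by
  have hnhds : Set.Ioo (cell e s - e / 2 : ℝ) (cell e s + 1 - e / 2) ∈ 𝓝 s :=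
    Ioo_mem_nhds (by linarith [cell_lt hs]) (by linarith [lt_cell_add_one e s])
  filter_upwards [hnhds] with u hu
  have hcell : cell e u = cell e s :=
    Int.floor_eq_iff.2 ⟨by linarith [hu.1], by linarith [hu.2]⟩
  refine ⟨fun m hm => ?_, hcell⟩
  have hm' : cell e u = m := by rw [cell, hm, Int.floor_intCast]
  rw [← hcell, hm'] at hu
  linarith [hu.1]

lemma snap_add_intCast (e : ℕ) (s : ℝ) (m : ℤ) : snap e (s + m) = snap e s + m := by
  rw [snap, snap, cell_add_intCast]
  push_cast
  ring

lemma snap_intCast_sub {e : ℕ} {s : ℝ} (hs : s ∈ offGrid e) (n : ℤ) :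
    snap e (n - s) = n - snap e s := by
  rw [snap, snap, cell_intCast_sub hs]
  push_cast
  ring

lemma snap_mem_Icc {e : ℕ} (he : e < 2) {s : ℝ} (hs : s ∈ offGrid e) {k : ℤ}
    (hk : s ∈ Set.Icc (k : ℝ) (k + 1)) : snap e s ∈ Set.Icc (k : ℝ) (k + 1) := by
  obtain ⟨h₁, h₂⟩ := cell_mem_Icc he hs hk
  have h₁' : (k : ℝ) ≤ cell e s := by exact_mod_cast h₁
  have h₂' : (cell e s : ℝ) ≤ k + e := by exact_mod_cast h₂
  have he' : (e : ℝ) ≤ 1 := by exact_mod_cast Nat.lt_succ_iff.1 he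
  rw [snap]
  constructor <;> linarith

end Cells

section Polar

open Topology unitInterval

/-- The point with polar coordinates `r` and `2 π s / (4 g)`. -/
noncomputable def polar (g : ℕ) (r : I) (s : ℝ) : PolygonDisc :=
  ⟨r * Complex.exp ((2 * Real.pi * s / (4 * g) : ℝ) * Complex.I), by
    rw [mem_closedBall_zero_iff, norm_mul, Complex.norm_exp_ofReal_mul_I, mul_one,
      Complex.norm_real, Real.norm_of_nonneg r.2.1]
    exact r.2.2⟩

/-- The distance from the centre of the polygon. -/
noncomputable def radius (z : PolygonDisc) : I :=
  ⟨‖(z : ℂ)‖, norm_nonneg _, mem_closedBall_zero_iff.1 z.2⟩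

/-- The angular coordinate, in which the sides have length one. -/
noncomputable def angle (g : ℕ) (z : PolygonDisc) : ℝ :=
  Complex.arg z * (4 * g) / (2 * Real.pi)

lemma coe_polar (g : ℕ) (r : I) (s : ℝ) : (polar g r s : ℂ) =
    r * Complex.exp ((2 * Real.pi * s / (4 * g) : ℝ) * Complex.I) := rfl

lemma coe_radius (z : PolygonDisc) : (radius z : ℝ) = ‖(z : ℂ)‖ := rfl

lemma polar_one (g : ℕ) (s : ℝ) : polar g 1 s = boundaryPoint g s :=
  Subtype.ext (by simp [polar, boundaryPoint])

lemma continuous_radius : Continuous radius := by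
  unfold radius
  fun_prop

lemma continuous_polar (g : ℕ) : Continuous fun x : I × ℝ => polar g x.1 x.2 := by
  unfold polar
  fun_prop

@[simp]
lemma radius_polar (g : ℕ) (r : I) (s : ℝ) : radius (polar g r s) = r :=
  Subtype.ext (by
    rw [coe_radius, coe_polar, norm_mul, Complex.norm_exp_ofReal_mul_I, mul_one, Complex.norm_real,
      Real.norm_of_nonneg r.2.1])

variable {g : ℕ} [NeZero g]

lemma polar_periodic (r : I) : Function.Periodic (polar g r) (4 * g) := by
  intro s
  have hg : (g : ℝ) ≠ 0 := Nat.cast_ne_zero.2 (NeZero.ne g)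
  have hturn : (2 * Real.pi * (s + 4 * g) / (4 * g) : ℝ) =
      2 * Real.pi * s / (4 * g) + 2 * Real.pi := by
    field_simp
  refine Subtype.ext (congrArg (_ * ·) (Complex.exp_eq_exp_iff_exists_int.2 ⟨1, ?_⟩))
  rw [hturn]
  push_cast
  ring

lemma exists_int_of_polar_eq_polar {r : I} (hr : r ≠ 0) {s s' : ℝ}
    (h : polar g r s = polar g r s') : ∃ m : ℤ, s = s' + m * (4 * g) := by
  have hr' : ((r : ℝ) : ℂ) ≠ 0 := Complex.ofReal_ne_zero.2 fun h => hr (Subtype.ext h)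
  obtain ⟨m, hm⟩ := Complex.exp_eq_exp_iff_exists_int.1
    (mul_left_cancel₀ hr' (congrArg Subtype.val h))
  have hcomplex : ((2 * Real.pi * s / (4 * g) : ℝ) : ℂ) =
      ((2 * Real.pi * s' / (4 * g) + m * (2 * Real.pi) : ℝ) : ℂ) := by
    apply mul_right_cancel₀ Complex.I_ne_zero
    rw [hm]
    push_cast
    ring
  have hreal := Complex.ofReal_injective hcomplex
  have hg : (g : ℝ) ≠ 0 := Nat.cast_ne_zero.2 (NeZero.ne g)
  have := Real.pi_ne_zero
  field_simp at hreal
  exact ⟨m, by linarith⟩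

lemma polar_angle_add {z w : PolygonDisc} {u : ℂ}
    (hu : u = Complex.exp (Complex.arg z * Complex.I)) :
    polar g (radius w) (angle g z + Complex.arg (w / u) * (4 * g) / (2 * Real.pi)) = w := by
  have hg : (g : ℝ) ≠ 0 := Nat.cast_ne_zero.2 (NeZero.ne g)
  have hpi := Real.pi_ne_zero
  have hnorm : ‖(w : ℂ)‖ = ‖(w : ℂ) / u‖ := by
    rw [norm_div, hu, Complex.norm_exp_ofReal_mul_I, div_one]
  have hangle : (2 * Real.pi * (angle g z + Complex.arg (w / u) * (4 * g) / (2 * Real.pi)) /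
      (4 * g) : ℝ) = Complex.arg z + Complex.arg (w / u) := by
    rw [angle]
    field_simp
  refine Subtype.ext ?_
  rw [coe_polar, hangle, Complex.ofReal_add, add_mul, Complex.exp_add, ← hu, coe_radius, hnorm,
    mul_left_comm, Complex.norm_mul_exp_arg_mul_I, mul_div_cancel₀ _ (hu ▸ Complex.exp_ne_zero _)]

lemma exists_angle_lift {z : PolygonDisc} (hz : radius z ≠ 0) :
    ∃ s : PolygonDisc → ℝ, ContinuousAt s z ∧ s z = angle g z ∧
      ∀ w, polar g (radius w) (s w) = w := by
  let u : ℂ := Complex.exp (Complex.arg z * Complex.I)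
  have hzu : (z : ℂ) / u = (‖(z : ℂ)‖ : ℂ) :=
    (div_eq_iff (Complex.exp_ne_zero _)).2 (Complex.norm_mul_exp_arg_mul_I z).symm
  have hz₀ : 0 < ‖(z : ℂ)‖ := lt_of_le_of_ne (norm_nonneg _) fun h => hz (Subtype.ext h.symm)
  refine ⟨fun w => angle g z + Complex.arg (w / u) * (4 * g) / (2 * Real.pi), ?_, ?_,
    fun w => polar_angle_add rfl⟩
  · have harg : ContinuousAt (fun w : PolygonDisc => Complex.arg ((w : ℂ) / u)) z :=
      ContinuousAt.comp (g := Complex.arg)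
        (Complex.continuousAt_arg (hzu ▸ Complex.ofReal_mem_slitPlane.2 hz₀)) (by fun_prop)
    fun_prop
  · simp [hzu, Complex.arg_ofReal_of_nonneg hz₀.le]

lemma polar_radius_angle (z : PolygonDisc) : polar g (radius z) (angle g z) = z := by
  by_cases hz : radius z = 0
  · have hz₀ : (z : ℂ) = 0 := norm_eq_zero.1 (congrArg Subtype.val hz)
    exact Subtype.ext (by simp [coe_polar, hz, hz₀])
  · obtain ⟨s, -, hs, hpolar⟩ := exists_angle_lift (g := g) hz
    rw [← hs, hpolar]

lemma apply_angle_of_periodic {α : Type*} {F : ℝ → α} (hF : F.Periodic (4 * g)) {z : PolygonDisc}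
    (hz : radius z ≠ 0) {s : ℝ} (h : polar g (radius z) s = z) : F (angle g z) = F s := by
  obtain ⟨m, rfl⟩ := exists_int_of_polar_eq_polar hz (h.trans (polar_radius_angle z).symm)
  exact (hF.int_mul m _).symm

/-- The points of the punctured polygon whose angular coordinate is off the grid `ℤ - e / 2`. For
`e = 0` these are the open sectors over the sides, for `e = 1` those around the corners. -/
def sectors (g e : ℕ) : Set PolygonDisc := {z | radius z ≠ 0 ∧ angle g z ∈ offGrid e}

lemma polar_mem_sectors {e : ℕ} {r : I} (hr : r ≠ 0) {s : ℝ} :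
    polar g r s ∈ sectors g e ↔ s ∈ offGrid e := by
  have hperiodic : Function.Periodic (· ∈ offGrid e) (4 * g : ℝ) := fun s =>
    propext (by exact_mod_cast add_intCast_mem_offGrid (4 * g : ℤ))
  have hangle : (angle g (polar g r s) ∈ offGrid e) = (s ∈ offGrid e) :=
    apply_angle_of_periodic hperiodic (by rwa [radius_polar]) (by rw [radius_polar])
  rw [sectors, Set.mem_ofPred_eq, radius_polar, hangle, and_iff_right hr]

lemma exists_angle_lift_sectors {e : ℕ} {z : PolygonDisc} (hz : z ∈ sectors g e) :
    ∃ s : PolygonDisc → ℝ, ContinuousAt s z ∧ (∀ w, polar g (radius w) (s w) = w) ∧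
      ∀ᶠ w in 𝓝 z, w ∈ sectors g e ∧ cell e (s w) = cell e (angle g z) := by
  obtain ⟨s, hcont, hsz, hs⟩ := exists_angle_lift (g := g) hz.1
  refine ⟨s, hcont, hs, ?_⟩
  filter_upwards [continuous_radius.continuousAt.eventually_ne hz.1,
    hcont.eventually (eventually_cell_eq (s := s z) (hsz ▸ hz.2))] with w hw hcell
  refine ⟨?_, hsz ▸ hcell.2⟩
  rw [← hs w, polar_mem_sectors hw]
  exact hcell.1

lemma isOpen_sectors (e : ℕ) : IsOpen (sectors g e) := by
  refine isOpen_iff_mem_nhds.2 fun z hz => ?_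
  obtain ⟨s, -, -, h⟩ := exists_angle_lift_sectors hz
  filter_upwards [h] with w hw using hw.1

end Polar

/-! ### Contractible patches of the surface -/

section Surface

open Topology unitInterval

/-- The projection from the polygon to the surface. -/
def surfaceProj (g : ℕ) : C(PolygonDisc, ClosedSurface g) :=
  ⟨Quot.mk (SidePairing g), continuous_quot_mk⟩

lemma isQuotientMap_surfaceProj (g : ℕ) : IsQuotientMap (surfaceProj g) := isQuotientMap_quot_mk

instance PolygonDisc.instContractibleSpace : ContractibleSpace PolygonDisc :=
  (convex_closedBall (0 : ℂ) 1).contractibleSpace ⟨0, by simp⟩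

/-- The centre of the polygon, over which the base point of the surface is chosen. -/
def centre : PolygonDisc := ⟨0, by simp⟩

/-- The first corner of the side `a_j` (for `r = 0`) or `b_j` (for `r = 1`). With `k` this corner,
the side pairing is the reflection `s ↦ 2 * k + 3 - s`. -/
def sideStart (r : Fin 2) (j : ℕ) : ℕ := 4 * j + r

lemma SidePairing.exists_polar {g : ℕ} {z w : PolygonDisc} (h : SidePairing g z w) :
    ∃ r, ∃ j < g, ∃ s ∈ Set.Icc (sideStart r j : ℝ) (sideStart r j + 1),
      z = polar g 1 s ∧ w = polar g 1 (2 * sideStart r j + 3 - s) := by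
  cases h with
  | a j t ht =>
    refine ⟨0, j, j.2, 4 * (j : ℕ) + t, ?_, (polar_one _ _).symm, ?_⟩
    · simpa [sideStart] using ht
    · rw [polar_one]
      congr 1
      push_cast [sideStart, Fin.val_zero]
      ring
  | b j t ht =>
    refine ⟨1, j, j.2, 4 * (j : ℕ) + 1 + t, ?_, (polar_one _ _).symm, ?_⟩
    · simpa [sideStart] using ht
    · rw [polar_one]
      congr 1
      push_cast [sideStart, Fin.val_one]
      ring

lemma SidePairing.of_polar {g : ℕ} (r : Fin 2) {j : ℕ} (hj : j < g) {s : ℝ}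
    (hs : s ∈ Set.Icc (sideStart r j : ℝ) (sideStart r j + 1)) :
    SidePairing g (polar g 1 s) (polar g 1 (2 * sideStart r j + 3 - s)) := by
  have ht : s - sideStart r j ∈ Set.Icc (0 : ℝ) 1 :=
    ⟨sub_nonneg.2 hs.1, sub_le_iff_le_add'.2 hs.2⟩
  rw [polar_one, polar_one]
  fin_cases r
  · convert SidePairing.a ⟨j, hj⟩ _ ht using 2
    · simp [sideStart]
    · simp [sideStart]
      ring
  · convert SidePairing.b ⟨j, hj⟩ _ ht using 2
    · simp [sideStart]
    · simp [sideStart]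
      ring

lemma surfaceProj_polar {g : ℕ} (r : Fin 2) {j : ℕ} (hj : j < g) {s : ℝ}
    (hs : s ∈ Set.Icc (sideStart r j : ℝ) (sideStart r j + 1)) :
    surfaceProj g (polar g 1 s) = surfaceProj g (polar g 1 (2 * sideStart r j + 3 - s)) :=
  Quot.sound (.of_polar r hj hs)

/-- A set of points of the polygon is saturated if it is a union of fibres of the projection to the
surface. -/
def IsSaturated (g : ℕ) (V : Set PolygonDisc) : Prop :=
  ∀ z w, SidePairing g z w → (z ∈ V ↔ w ∈ V)

namespace IsSaturated

variable {g : ℕ} {V : Set PolygonDisc}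

lemma mem_iff (hV : IsSaturated g V) {z w : PolygonDisc}
    (h : surfaceProj g z = surfaceProj g w) : z ∈ V ↔ w ∈ V :=
  iff_of_eq (congrArg (Quot.lift (· ∈ V) fun z w h => propext (hV z w h)) h)

lemma mem_image_iff (hV : IsSaturated g V) {z : PolygonDisc} :
    surfaceProj g z ∈ surfaceProj g '' V ↔ z ∈ V :=
  ⟨fun ⟨_, hw, h⟩ => (hV.mem_iff h).1 hw, fun h => ⟨z, h, rfl⟩⟩

lemma isOpen_image (hV : IsSaturated g V) (hopen : IsOpen V) : IsOpen (surfaceProj g '' V) := by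
  rw [← (isQuotientMap_surfaceProj g).isOpen_preimage]
  convert hopen
  exact Set.ext fun z => hV.mem_image_iff

lemma eq_of_surfaceProj_eq (hV : IsSaturated g V) {α : Type*} {f : PolygonDisc → α}
    (hf : ∀ z w, SidePairing g z w → z ∈ V → f z = f w) {z w : PolygonDisc}
    (h : surfaceProj g z = surfaceProj g w) (hz : z ∈ V) : f z = f w := by
  have hzw : Relation.EqvGen (SidePairing g) z w := Quot.eqvGen_exact h
  induction hzw with
  | rel z w hzw => exact hf z w hzw hz
  | refl z => rfl
  | symm z w _ ih => exact (ih h.symm ((hV.mem_iff h).1 hz)).symm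
  | trans z v w hzv hvw ih ih' =>
    have hv : surfaceProj g z = surfaceProj g v := Quot.eqvGen_sound hzv
    exact (ih hv hz).trans (ih' (Quot.eqvGen_sound hvw) ((hV.mem_iff hv).1 hz))

end IsSaturated

/-- The interior of the polygon. -/
def openPolygon : Set PolygonDisc := {z | radius z ≠ 1}

lemma isOpen_openPolygon : IsOpen openPolygon := isOpen_ne.preimage continuous_radius

lemma SidePairing.notMem_openPolygon {g : ℕ} {z w : PolygonDisc} (h : SidePairing g z w) :
    z ∉ openPolygon ∧ w ∉ openPolygon := by
  obtain ⟨r, j, -, s, -, rfl, rfl⟩ := h.exists_polar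
  simp [openPolygon]

lemma isSaturated_openPolygon (g : ℕ) : IsSaturated g openPolygon := fun _ _ h =>
  iff_of_false h.notMem_openPolygon.1 h.notMem_openPolygon.2

/-- The radial contraction of the polygon to its centre. -/
noncomputable def shrink : C(PolygonDisc, C(I, PolygonDisc)) :=
  ContinuousMap.curry ⟨fun x => ⟨((σ x.2 : ℝ) : ℂ) * x.1, by
    rw [mem_closedBall_zero_iff, norm_mul, Complex.norm_real, Real.norm_of_nonneg (σ x.2).2.1]
    exact mul_le_one₀ (σ x.2).2.2 (norm_nonneg _) (mem_closedBall_zero_iff.1 x.1.2)⟩, by fun_prop⟩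

lemma isContraction_shrink (g : ℕ) :
    IsContraction (surfaceProj g) (surfaceProj g '' openPolygon) shrink where
  isOpen := (isSaturated_openPolygon g).isOpen_image isOpen_openPolygon
  continuousOn := shrink.continuous.continuousOn
  start z _ := Subtype.ext (by simp [shrink])
  compat z w h hz t := (isSaturated_openPolygon g).eq_of_surfaceProj_eq
    (f := fun z => surfaceProj g (shrink z t)) (fun _ _ h hz => absurd hz h.notMem_openPolygon.1) h
    ((isSaturated_openPolygon g).mem_image_iff.1 hz)
  eventually_eq z _ := .of_forall fun w => congrArg _ (Subtype.ext (by simp [shrink]))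

/-- The path from the point with polar coordinates `(r, s)` to the boundary point with angular
coordinate `b` along which both coordinates change linearly. -/
noncomputable def snapCurve (g : ℕ) (b : ℝ) : C(I × ℝ, C(I, PolygonDisc)) :=
  ContinuousMap.curry ⟨fun x => polar g (σ (σ x.1.1 * σ x.2)) ((1 - x.2) * x.1.2 + x.2 * b),
    (continuous_polar g).comp (f := fun x : (I × ℝ) × I =>
      (σ (σ x.1.1 * σ x.2), (1 - (x.2 : ℝ)) * x.1.2 + x.2 * b)) (by fun_prop)⟩

lemma snapCurve_apply (g : ℕ) (b : ℝ) (r : I) (s : ℝ) (t : I) :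
    snapCurve g b (r, s) t = polar g (σ (σ r * σ t)) ((1 - t) * s + t * b) := rfl

/-- The contraction of every sector to the midpoint of its boundary arc. -/
noncomputable def sectorSnap (g e : ℕ) (z : PolygonDisc) : C(I, PolygonDisc) :=
  snapCurve g (snap e (angle g z)) (radius z, angle g z)

variable {g : ℕ} [NeZero g]

lemma sectorSnap_eq (e : ℕ) {z : PolygonDisc} (hz : radius z ≠ 0) {s : ℝ}
    (h : polar g (radius z) s = z) : sectorSnap g e z = snapCurve g (snap e s) (radius z, s) := by
  refine apply_angle_of_periodic (F := fun s => snapCurve g (snap e s) (radius z, s))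
    (fun s => ContinuousMap.ext fun t => ?_) hz h
  have hsnap : snap e (s + 4 * g) = snap e s + 4 * g := by
    exact_mod_cast snap_add_intCast e s (4 * g)
  rw [snapCurve_apply, snapCurve_apply, hsnap, ← polar_periodic _ ((1 - t) * s + t * snap e s)]
  congr 1
  ring

lemma sectorSnap_polar_one (e : ℕ) (s : ℝ) (t : I) :
    sectorSnap g e (polar g 1 s) t = polar g 1 ((1 - t) * s + t * snap e s) := by
  rw [sectorSnap_eq e (s := s) (by simp) (by simp), snapCurve_apply, radius_polar]
  simp

lemma isSaturated_sectors (e : ℕ) : IsSaturated g (sectors g e) := by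
  intro z w h
  obtain ⟨r, j, -, s, -, rfl, rfl⟩ := h.exists_polar
  rw [polar_mem_sectors one_ne_zero, polar_mem_sectors one_ne_zero]
  exact_mod_cast (intCast_sub_mem_offGrid (2 * sideStart r j + 3 : ℤ)).symm

lemma SidePairing.surfaceProj_sectorSnap_eq {e : ℕ} (he : e < 2) {z w : PolygonDisc}
    (h : SidePairing g z w) (hz : z ∈ sectors g e) (t : I) :
    surfaceProj g (sectorSnap g e z t) = surfaceProj g (sectorSnap g e w t) := by
  obtain ⟨r, j, hj, s, hs, rfl, rfl⟩ := h.exists_polar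
  replace hz := (polar_mem_sectors one_ne_zero).1 hz
  have hsnap : snap e (2 * sideStart r j + 3 - s) = 2 * sideStart r j + 3 - snap e s := by
    exact_mod_cast snap_intCast_sub hz (2 * sideStart r j + 3)
  have hmem : (1 - t) * s + t * snap e s ∈ Set.Icc (sideStart r j : ℝ) (sideStart r j + 1) :=
    (convex_Icc _ _) hs (by exact_mod_cast snap_mem_Icc he hz (k := sideStart r j) hs)
      (sub_nonneg.2 t.2.2) t.2.1 (sub_add_cancel _ _)
  rw [sectorSnap_polar_one, sectorSnap_polar_one, surfaceProj_polar r hj hmem, hsnap]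
  congr 2
  ring

lemma eventually_sectorSnap_eq {e : ℕ} {z : PolygonDisc} (hz : z ∈ sectors g e) :
    ∃ s : PolygonDisc → ℝ, ContinuousAt s z ∧
      ∀ᶠ w in 𝓝 z, sectorSnap g e w = snapCurve g (snap e (angle g z)) (radius w, s w) := by
  obtain ⟨s, hcont, hs, hcell⟩ := exists_angle_lift_sectors hz
  refine ⟨s, hcont, ?_⟩
  filter_upwards [hcell] with w hw
  rw [sectorSnap_eq e hw.1.1 (hs w), snap, hw.2, snap]

lemma isContraction_sectorSnap {e : ℕ} (he : e < 2) :
    IsContraction (surfaceProj g) (surfaceProj g '' sectors g e) (sectorSnap g e) where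
  isOpen := (isSaturated_sectors e).isOpen_image (isOpen_sectors e)
  continuousOn z hz := by
    obtain ⟨s, hcont, hs⟩ := eventually_sectorSnap_eq ((isSaturated_sectors e).mem_image_iff.1 hz)
    exact (((snapCurve g _).continuous.continuousAt.comp
      (continuous_radius.continuousAt.prodMk hcont)).congr
        (hs.mono fun _ h => h.symm)).continuousWithinAt
  start z _ := by
    rw [sectorSnap, snapCurve_apply]
    simp [polar_radius_angle]
  compat z w h hz t := (isSaturated_sectors e).eq_of_surfaceProj_eq
    (f := fun z => surfaceProj g (sectorSnap g e z t))
    (fun _ _ h hz => h.surfaceProj_sectorSnap_eq he hz t) h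
    ((isSaturated_sectors e).mem_image_iff.1 hz)
  eventually_eq z hz := by
    obtain ⟨s, -, hs⟩ := eventually_sectorSnap_eq ((isSaturated_sectors e).mem_image_iff.1 hz)
    filter_upwards [hs] with w hw
    rw [hw, sectorSnap, snapCurve_apply, snapCurve_apply]
    simp

/-- Three saturated open sets that cover the polygon: the interior, the sectors over the sides and
the sectors around the corners. -/
def patch (g : ℕ) : Option (Fin 2) → Set PolygonDisc
  | none => openPolygon
  | some e => sectors g e

lemma isSaturated_patch : ∀ i, IsSaturated g (patch g i)
  | none => isSaturated_openPolygon g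
  | some e => isSaturated_sectors e

lemma isOpen_image_patch : ∀ i, IsOpen (surfaceProj g '' patch g i)
  | none => (isContraction_shrink g).isOpen
  | some e => (isContraction_sectorSnap e.2).isOpen

lemma exists_mem_patch (g : ℕ) (z : PolygonDisc) : ∃ i, z ∈ patch g i := by
  by_cases hz : radius z = 1
  · by_cases hangle : ∃ m : ℤ, angle g z = m
    · obtain ⟨m, hm⟩ := hangle
      refine ⟨some 1, by simp [hz], fun n hn => ?_⟩
      have hodd : (2 * m + 1 : ℝ) = 2 * n := by
        rw [← hn, hm]
        push_cast [Fin.val_one]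
        ring
      have hodd' : 2 * m + 1 = 2 * n := by exact_mod_cast hodd
      omega
    · exact ⟨some 0, by simp [hz], fun n hn => hangle ⟨n, by simpa using hn⟩⟩
  · exact ⟨none, hz⟩

lemma iUnion_image_patch (g : ℕ) : ⋃ i, surfaceProj g '' patch g i = Set.univ := by
  refine Set.eq_univ_of_forall fun x => ?_
  obtain ⟨z, rfl⟩ := (isQuotientMap_surfaceProj g).surjective x
  obtain ⟨i, hi⟩ := exists_mem_patch g z
  exact Set.mem_iUnion.2 ⟨i, z, hi, rfl⟩

/-- The contractions of the patches. -/
noncomputable def patchContraction (g : ℕ) : Option (Fin 2) → PolygonDisc → C(I, PolygonDisc)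
  | none => shrink
  | some e => sectorSnap g e

lemma isContraction_patchContraction :
    ∀ i, IsContraction (surfaceProj g) (surfaceProj g '' patch g i) (patchContraction g i)
  | none => isContraction_shrink g
  | some e => isContraction_sectorSnap e.2

end Surface

/-! ### The standard generators of the surface group -/

section Generators

open unitInterval

variable {g : ℕ}

/-- The path along the boundary of the polygon whose angular coordinate changes linearly. -/
noncomputable def boundaryPath (g : ℕ) (a b : ℝ) : Path (polar g 1 a) (polar g 1 b) where
  toFun t := polar g 1 ((1 - t) * a + t * b)
  continuous_toFun := (continuous_polar g).comp
    (f := fun t : I => ((1 : I), (1 - (t : ℝ)) * a + t * b)) (by fun_prop)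
  source' := by simp
  target' := by simp

lemma boundaryPath_apply (g : ℕ) (a b : ℝ) (t : I) :
    boundaryPath g a b t = polar g 1 ((1 - t) * a + t * b) := rfl

/-- The generator of the surface group belonging to the side `a_j` (for `r = 0`) or `b_j` (for
`r = 1`): the loop that leaves the polygon through this side and returns through the paired side. -/
noncomputable def sideLoop (g : ℕ) (r : Fin 2) (j : ℕ) :
    FundamentalGroup (ClosedSurface g) (surfaceProj g centre) :=
  if h : j < g then
    jump (surfaceProj g) centre _ _ (surfaceProj_polar r h (Set.left_mem_Icc.2 (by simp)))
  else 1

lemma sideLoop_eq_jump (r : Fin 2) {j : ℕ} (hj : j < g) {s : ℝ}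
    (hs : s ∈ Set.Icc (sideStart r j : ℝ) (sideStart r j + 1)) :
    sideLoop g r j = jump (surfaceProj g) centre _ _ (surfaceProj_polar r hj hs) := by
  rw [sideLoop, dif_pos hj]
  refine jump_congr_of_paths _ _ (boundaryPath g _ _) (boundaryPath g _ _) (fun t => ?_) _ _
  have hmem : (1 - t) * (sideStart r j : ℝ) + t * s ∈
      Set.Icc (sideStart r j : ℝ) (sideStart r j + 1) :=
    (convex_Icc _ _) (Set.left_mem_Icc.2 (by simp)) hs (sub_nonneg.2 t.2.2) t.2.1
      (sub_add_cancel _ _)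
  rw [boundaryPath_apply, boundaryPath_apply, surfaceProj_polar r hj hmem]
  congr 2
  ring

lemma exists_jump_corner_eq_sideLoop (r : Fin 2) {j : ℕ} (hj : j < g) {m n : ℕ}
    (hm : m ∈ Set.Icc (sideStart r j) (sideStart r j + 1)) (hmn : m + n = 2 * sideStart r j + 3) :
    ∃ h, jump (surfaceProj g) centre (polar g 1 m) (polar g 1 n) h = sideLoop g r j := by
  have hs : (m : ℝ) ∈ Set.Icc (sideStart r j : ℝ) (sideStart r j + 1) :=
    ⟨by exact_mod_cast hm.1, by exact_mod_cast hm.2⟩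
  have hn : (n : ℝ) = 2 * sideStart r j + 3 - m := eq_sub_of_add_eq' (by exact_mod_cast hmn)
  rw [hn]
  exact ⟨_, (sideLoop_eq_jump r hj hs).symm⟩

-- The sides of the `n`-th handle identify its corners in the order `4n, 4n + 3, 4n + 2, 4n + 1,
-- 4n + 4`.
lemma exists_jump_corner_eq_handleProd {n : ℕ} (hn : n ≤ g) :
    ∃ h, jump (surfaceProj g) centre (polar g 1 (0 : ℕ)) (polar g 1 (4 * n : ℕ)) h =
      handleProd (sideLoop g) n := by
  induction n with
  | zero => exact ⟨rfl, jump_self _ _ _⟩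
  | succ n ih =>
    obtain ⟨h, ih⟩ := ih (by omega)
    have hcorner (r : Fin 2) {m k : ℕ} := exists_jump_corner_eq_sideLoop r hn (m := m) (n := k)
    obtain ⟨h₁, e₁⟩ := hcorner 0 (m := 4 * n) (k := 4 * n + 3)
      (by simp [sideStart]) (by simp [sideStart]; ring)
    obtain ⟨h₂, e₂⟩ := hcorner 1 (m := 4 * n + 2) (k := 4 * n + 3)
      (by simp [sideStart]) (by simp [sideStart]; ring)
    obtain ⟨h₃, e₃⟩ := hcorner 0 (m := 4 * n + 1) (k := 4 * n + 2)
      (by simp [sideStart]) (by simp [sideStart]; ring)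
    obtain ⟨h₄, e₄⟩ := hcorner 1 (m := 4 * n + 1) (k := 4 * n + 4)
      (by simp [sideStart]) (by simp [sideStart]; ring)
    refine ⟨h.trans (h₁.trans (h₂.symm.trans (h₃.symm.trans h₄))), Eq.symm ?_⟩
    calc handleProd (sideLoop g) (n + 1)
      _ = sideLoop g 1 n * (sideLoop g 0 n)⁻¹ * (sideLoop g 1 n)⁻¹ * sideLoop g 0 n *
          handleProd (sideLoop g) n := rfl
      _ = jump _ _ _ _ h₄ * jump _ _ _ _ h₃.symm * jump _ _ _ _ h₂.symm * jump _ _ _ _ h₁ *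
          jump _ _ _ _ h := by rw [← jump_inv _ _ h₂, ← jump_inv _ _ h₃, e₁, e₂, e₃, e₄, ih]
      _ = _ := by simp only [jump_mul]; rfl

theorem handleProd_sideLoop (g : ℕ) [NeZero g] : handleProd (sideLoop g) g = 1 := by
  obtain ⟨h, hg⟩ := exists_jump_corner_eq_handleProd (le_refl g)
  have hperiod : polar g 1 (4 * g : ℕ) = polar g 1 (0 : ℕ) := by
    simpa using polar_periodic (g := g) 1 0
  rw [← hg]
  generalize polar g 1 (4 * g : ℕ) = z at *
  subst hperiod
  exact jump_self _ _ _

theorem closure_sideLoop (g : ℕ) [NeZero g] :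
    Subgroup.closure (⋃ r, sideLoop g r '' Set.Iio g) = ⊤ := by
  refine eq_top_of_jump_mem (isQuotientMap_surfaceProj g) centre isContraction_patchContraction
    (iUnion_image_patch g) _ fun z w h => ?_
  have hzw : Relation.EqvGen (SidePairing g) z w := Quot.eqvGen_exact h
  induction hzw with
  | rel z w hzw =>
    obtain ⟨r, j, hj, s, hs, rfl, rfl⟩ := hzw.exists_polar
    rw [← sideLoop_eq_jump r hj hs]
    exact Subgroup.subset_closure (Set.mem_iUnion.2 ⟨r, j, hj, rfl⟩)
  | refl z =>
    rw [jump_self]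
    exact one_mem _
  | symm z w _ ih => exact jump_inv _ _ h.symm ▸ inv_mem (ih h.symm)
  | trans z v w hzv hvw ih ih' =>
    have hv : surfaceProj g z = surfaceProj g v := Quot.eqvGen_sound hzv
    have hw : surfaceProj g v = surfaceProj g w := Quot.eqvGen_sound hvw
    exact jump_mul _ _ hv hw ▸ mul_mem (ih' hw) (ih hv)

end Generators

/-! ### Permutation representations of the surface group -/

section Labels

open Topology

variable {G : Type*} [Group G]

/-- The labels of the sides: they are `1` on the first two sides of a handle and make up the
transition across the pairing on the other two. -/
def sideLabel (C : Fin 2 → ℕ → G) (i : ℕ) : G :=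
  match i % 4 with
  | 0 | 1 => 1
  | 2 => C 0 (i / 4)
  | _ => C 1 (i / 4)

/-- The labels of the corners: starting with `1`, the only ones that are compatible with the
transitions across the sides. -/
def cornerLabel (C : Fin 2 → ℕ → G) (i : ℕ) : G :=
  match i % 4 with
  | 0 => handleProd C (i / 4)
  | 1 => (C 1 (i / 4))⁻¹ * handleProd C (i / 4 + 1)
  | 2 => (C 1 (i / 4))⁻¹ * C 0 (i / 4) * handleProd C (i / 4)
  | _ => C 0 (i / 4) * handleProd C (i / 4)

/-- The labels of the sides (for `e = 0`) or the corners (for `e = 1`) of the `4 * g`-gon, numbered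
cyclically. -/
def polygonLabel (g : ℕ) (C : Fin 2 → ℕ → G) (e : Fin 2) (m : ℤ) : G :=
  ![sideLabel C, cornerLabel C] e (m % (4 * g)).toNat

lemma polygonLabel_periodic (g : ℕ) (C : Fin 2 → ℕ → G) (e : Fin 2) :
    (polygonLabel g C e).Periodic (4 * g) := fun m => by
  rw [polygonLabel, polygonLabel, Int.add_emod_right]

lemma polygonLabel_natCast {g : ℕ} {C : Fin 2 → ℕ → G} (hC : handleProd C g = 1) (e : Fin 2)
    {i : ℕ} (hi : i < 4 * g + e) : polygonLabel g C e i = ![sideLabel C, cornerLabel C] e i := by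
  rcases lt_or_ge i (4 * g) with hlt | hge
  · have hmod : ((i : ℤ) % (4 * g)).toNat = i := by
      rw [Int.emod_eq_of_lt (by omega) (by omega), Int.toNat_natCast]
    rw [polygonLabel, hmod]
  · obtain ⟨rfl, rfl⟩ : e = 1 ∧ i = 4 * g := by omega
    have hmod : (((4 * g : ℕ) : ℤ) % (4 * g)).toNat = 0 := by simp
    rw [polygonLabel, hmod]
    simp [cornerLabel, hC, handleProd]

lemma sideLabel_paired (C : Fin 2 → ℕ → G) (r : Fin 2) (j : ℕ) :
    sideLabel C (sideStart r j + 2) = C r j * sideLabel C (sideStart r j) := by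
  fin_cases r <;> simp [sideLabel, sideStart, Nat.add_mod, Nat.add_div]

lemma cornerLabel_paired_start (C : Fin 2 → ℕ → G) (r : Fin 2) (j : ℕ) :
    cornerLabel C (sideStart r j + 3) = C r j * cornerLabel C (sideStart r j) := by
  fin_cases r <;> simp [cornerLabel, sideStart, Nat.add_mod, Nat.add_div, handleProd]

lemma cornerLabel_paired_end (C : Fin 2 → ℕ → G) (r : Fin 2) (j : ℕ) :
    cornerLabel C (sideStart r j + 2) = C r j * cornerLabel C (sideStart r j + 1) := by
  fin_cases r <;> simp [cornerLabel, sideStart, Nat.add_mod, Nat.add_div, handleProd, handle,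
    mul_assoc]

lemma polygonLabel_paired {g : ℕ} {C : Fin 2 → ℕ → G} (hC : handleProd C g = 1) (e r : Fin 2)
    {j : ℕ} (hj : j < g) {m : ℤ}
    (hm : m ∈ Set.Icc (sideStart r j : ℤ) (sideStart r j + (e : ℕ))) :
    polygonLabel g C e (2 * sideStart r j + 2 + (e : ℕ) - m) = C r j * polygonLabel g C e m := by
  have := r.2
  have hlabel {i : ℕ} (hi : i < 4 * g + (e : ℕ)) := polygonLabel_natCast hC e hi
  obtain ⟨i, rfl⟩ := Int.eq_ofNat_of_zero_le (le_trans (by positivity) hm.1)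
  have hi : i = sideStart r j ∨ e = 1 ∧ i = sideStart r j + 1 := by
    obtain ⟨h₁, h₂⟩ := hm
    omega
  have hcast : (2 * sideStart r j + 2 + (e : ℕ) - i : ℤ) = (2 * sideStart r j + 2 + e - i : ℕ) := by
    omega
  rw [hcast, hlabel (by grind [sideStart]), hlabel (by grind [sideStart])]
  rcases hi with rfl | ⟨rfl, rfl⟩
  · have hpaired : 2 * sideStart r j + 2 + (e : ℕ) - sideStart r j = sideStart r j + 2 + e := by
      omega
    rw [hpaired]
    fin_cases e
    · exact sideLabel_paired C r j
    · exact cornerLabel_paired_start C r j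
  · have hpaired : 2 * sideStart r j + 2 + ((1 : Fin 2) : ℕ) - (sideStart r j + 1) =
        sideStart r j + 2 := by
      grind
    rw [hpaired]
    exact cornerLabel_paired_end C r j

/-- The labels of the components of the patches. -/
noncomputable def patchLabel (g : ℕ) (C : Fin 2 → ℕ → G) : Option (Fin 2) → PolygonDisc → G
  | none, _ => 1
  | some e, z => polygonLabel g C e (cell e (angle g z))

variable {g : ℕ} [NeZero g] {C : Fin 2 → ℕ → G}

lemma patchLabel_some (e : Fin 2) {z : PolygonDisc} (hz : radius z ≠ 0) {s : ℝ}
    (h : polar g (radius z) s = z) :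
    patchLabel g C (some e) z = polygonLabel g C e (cell e s) := by
  refine apply_angle_of_periodic (F := fun s => polygonLabel g C e (cell e s)) (fun s => ?_) hz h
  have hcell : cell e (s + 4 * g) = cell e s + 4 * g := by
    exact_mod_cast cell_add_intCast e s (4 * g)
  exact (congrArg _ hcell).trans (polygonLabel_periodic g C e _)

lemma eventually_patchLabel_eq : ∀ (i : Option (Fin 2)) {z : PolygonDisc}, z ∈ patch g i →
    ∀ᶠ w in 𝓝 z, patchLabel g C i w = patchLabel g C i z
  | none, _, _ => .of_forall fun _ => rfl
  | some e, z, hz => by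
    obtain ⟨s, -, hs, hcell⟩ := exists_angle_lift_sectors hz
    filter_upwards [hcell] with w hw
    rw [patchLabel_some e hw.1.1 (hs w), hw.2, patchLabel]

lemma patchLabel_paired (hC : handleProd C g = 1) (i : Option (Fin 2)) (r : Fin 2) {j : ℕ}
    (hj : j < g) {s : ℝ} (hs : s ∈ Set.Icc (sideStart r j : ℝ) (sideStart r j + 1))
    (hi : polar g 1 s ∈ patch g i) :
    patchLabel g C i (polar g 1 (2 * sideStart r j + 3 - s)) =
      C r j * patchLabel g C i (polar g 1 s) := by
  cases i with
  | none => exact absurd (radius_polar g 1 s) hi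
  | some e =>
    replace hi : s ∈ offGrid e := (polar_mem_sectors one_ne_zero).1 hi
    have hcell : cell e (2 * sideStart r j + 3 - s) =
        2 * sideStart r j + 2 + (e : ℕ) - cell e s := by
      have h := cell_intCast_sub hi (2 * sideStart r j + 3)
      push_cast at h
      rw [h]
      ring
    rw [patchLabel_some e (s := 2 * sideStart r j + 3 - s) (by simp) (by simp),
      patchLabel_some e (s := s) (by simp) (by simp), hcell]
    exact polygonLabel_paired hC e r hj (cell_mem_Icc e.2 hi (by exact_mod_cast hs))

lemma isTransitionLabelling_patchLabel (hC : handleProd C g = 1) :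
    IsTransitionLabelling (surfaceProj g) (fun i => surfaceProj g '' patch g i)
      (patchLabel g C) where
  isOpen := isOpen_image_patch
  iUnion_eq := iUnion_image_patch g
  eventually_eq i z hz := eventually_patchLabel_eq i ((isSaturated_patch i).mem_image_iff.1 hz)
  transition_eq i k z w h hi hk := by
    have hV : IsSaturated g (patch g i ∩ patch g k) := fun z w h =>
      and_congr (isSaturated_patch i z w h) (isSaturated_patch k z w h)
    refine hV.eq_of_surfaceProj_eq (f := fun z => (patchLabel g C k z)⁻¹ * patchLabel g C i z)
      (fun z w h hz => ?_) h
      ⟨(isSaturated_patch i).mem_image_iff.1 hi, (isSaturated_patch k).mem_image_iff.1 hk⟩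
    obtain ⟨r, j, hj, s, hs, rfl, rfl⟩ := h.exists_polar
    rw [patchLabel_paired hC i r hj hs hz.1, patchLabel_paired hC k r hj hs hz.2]
    group

end Labels

lemma exists_hom_sideLoop {g : ℕ} [NeZero g] {Y : Type*} {C : Fin 2 → ℕ → Equiv.Perm Y}
    (hC : handleProd C g = 1) :
    ∃ θ : FundamentalGroup (ClosedSurface g) (surfaceProj g centre) →* Equiv.Perm Y,
      ∀ r, ∀ j < g, θ (sideLoop g r j) = C r j := by
  obtain ⟨θ, hθ⟩ := exists_hom_jump_eq (isQuotientMap_surfaceProj g)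
    (isTransitionLabelling_patchLabel hC) centre
  refine ⟨θ, fun r j hj => ?_⟩
  have hs := Set.left_mem_Icc.2 (le_add_of_nonneg_right (a := (sideStart r j : ℝ)) zero_le_one)
  rw [sideLoop_eq_jump r hj hs]
  exact hθ _ _ _ _ fun i hi =>
    patchLabel_paired hC i r hj hs ((isSaturated_patch i).mem_image_iff.1 hi)

theorem isSurfacePresentation_sideLoop (g : ℕ) [NeZero g] :
    IsSurfacePresentation g (sideLoop g) where
  handleProd_eq_one := handleProd_sideLoop g
  closure_eq_top := closure_sideLoop g
  exists_hom _ _ := exists_hom_sideLoop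

open CategoryTheory in
/-- A homotopy equivalence induces an isomorphism of fundamental groups. -/
noncomputable def fundamentalGroupMulEquivOfHomotopyEquiv {X Z : Type*} [TopologicalSpace X]
    [TopologicalSpace Z] [PathConnectedSpace Z] (e : ContinuousMap.HomotopyEquiv X Z) (x : X)
    (z : Z) : FundamentalGroup X x ≃* FundamentalGroup Z z :=
  let F : FundamentalGroupoid X ≌ FundamentalGroupoid Z :=
    FundamentalGroupoidFunctor.equivOfHomotopyEquiv e
  (F.fullyFaithfulFunctor.mulEquivEnd ⟨x⟩).trans
    (FundamentalGroup.fundamentalGroupMulEquivOfPathConnected _ z)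

instance ClosedSurface.instPathConnectedSpace (g : ℕ) : PathConnectedSpace (ClosedSurface g) :=
  (isQuotientMap_surfaceProj g).surjective.pathConnectedSpace (surfaceProj g).continuous

theorem theorem1 (g : ℕ) (hg : 2 ≤ g) {X : Type*} [TopologicalSpace X]
    (e : X ≃ₜ ClosedSurface g) (x : X) :
    (∃ G : Subgroup (Equiv.Perm ℤ),
      Dense (G : Set (Equiv.Perm ℤ)) ∧ Nonempty (G ≃* FundamentalGroup X x)) ∧
    (∃ (Y : Type) (_ : Countable Y) (_ : Infinite Y) (_ : MulAction (FundamentalGroup X x) Y),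
      FaithfulSMul (FundamentalGroup X x) Y ∧ IsHighlyTransitive (FundamentalGroup X x) Y) := by
  have : NeZero g := ⟨by omega⟩
  have h : HasFaithfulHighlyTransitiveAction (FundamentalGroup X x) :=
    .of_mulEquiv
      (fundamentalGroupMulEquivOfHomotopyEquiv e.toHomotopyEquiv x (surfaceProj g centre))
      ((isSurfacePresentation_sideLoop g).hasFaithfulHighlyTransitiveAction hg)
  exact ⟨h.exists_dense_subgroup, h⟩
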